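/- Work in the asynchronous shared memory model with processes $p_1,\dots,p_n$. A deterministic data type consists of states, initial states, invocations, return values and a map $\delta:S\times\mathcal I\to\mathcal V\times S$. A history of one object is a finite or infinite sequence of invocation and response events of the processes; it is well-formed if, for each process, its events start with an invocation and alternate between invocations and matching responses. Let $H$ be well-formed. $H$ is weakly consistent if for each operation $o_1$, of process $p$, that has a response in $H$ there is a legal sequential history which contains only operations invoked in $H$ before $o_1$ returns, contains all operations of $p$ that precede $o_1$, and ends with $o_1$ and the same response as in $H$. For $t\ge 0$ let $H_t$ be $H$ without its first $t$ events. $H$ is $t$-linearizable if there is a legal sequential history $S$ such that (1) every operation in $S$ is invoked in $H$; (2) every operation completed in $H$ is completed in $S$; (3) if the response of $o_1$ precedes the invocation of $o_2$ in $H$, both events are in $H_t$ and $o_2$ is in $S$, then $o_1$ precedes $o_2$ in $S$; (4) every operation with a response in $H_t$ has the same response in $S$. $H$ is linearizable if it is $0$-linearizable, and eventually linearizable if it is weakly consistent and $t$-linearizable for some $t$. An implementation is a program that each process follows to perform operations of the implemented object; it does (Turing computable) local computation with a persistent local memory and accesses base objects. It is wait-free if in every execution each operation of a process that keeps taking steps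 completes, regardless of the other processes; it is eventually linearizable if the history of the implemented object is eventually linearizable in every (finite or infinite) execution. A fetch-and-cons object over a nonempty set $V$ of values (coded by natural numbers) stores a list, initially empty; $\mathrm{fac}(v)$ adds $v$ to the head of the list and returns the whole list stored before. The eventual consensus number of a data type $T$ is the largest $n$ such that eventually linearizable objects of type $T$ together with linearizable read/write registers (holding natural numbers) can wait-free implement an eventually linearizable fetch-and-cons object shared by $n$ processes ($\infty$ if there is no largest $n$). A test-and-set object stores a bit, initially $0$, and has a single operation, which sets the bit to $1$ and returns True if the bit was $0$ and False otherwise. **Theorem.** For every $n$, there is a wait-free eventually linearizable implementation of a test-and-set object shared by $n$ processes from a single linearizable register. Moreover, the test-and-set data type has eventual consensus number $1$ (for every choice of $V$). -/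

import Mathlib

namespace EventualLin

/-! ### Data types -/

/-- A deterministic abstract data type: states, possible initial states, invocations, return
values and a transition map. Invocations and return values carry a (primitive recursive) coding
by natural numbers, so that programs of Turing machines can handle them. -/
structure DataType where
  State : Type
  init : Set State
  Inv : Type
  Res : Type
  δ : State → Inv → Res × State
  [codableInv : Primcodable Inv]
  [codableRes : Primcodable Res]

attribute [instance] DataType.codableInv DataType.codableRes

/-- The same data type with `s` as its only initial state. -/
abbrev DataType.initialized (T : DataType) (s : T.State) : DataType :=
  { T with init := {s} }

/-- Read/write registers over `ℕ`. The invocation `none` is a read and returns `some` of the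
current value; the invocation `some v` writes `v` and returns the acknowledgement `none`.
A register may be initialized to any value. -/
abbrev Register : DataType where
  State := ℕ
  init := Set.univ
  Inv := Option ℕ
  Res := Option ℕ
  δ := fun s x => match x with
    | none => (some s, s)
    | some v => (none, v)

/-- Test-and-set: one operation, which sets the bit (initially `false`) and returns `true`
exactly if the bit was not set before. -/
abbrev TestAndSet : DataType where
  State := Bool
  init := {false}
  Inv := Unit
  Res := Bool
  δ := fun s _ => (!s, true)

/-- Fetch-and-cons over the values `V`: `fac v` adds `v` to the head of the list (initially
empty) and returns the whole list stored before. -/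
abbrev FetchAndCons (V : Type) [Primcodable V] : DataType where
  State := List V
  init := {[]}
  Inv := V
  Res := List V
  δ := fun L v => (L, v :: L)

/-! ### Histories of one object -/

/-- Events at one object: process `p` invokes `x`, or process `p` receives the response `v`. -/
inductive Event (n : ℕ) (T : DataType) where
  | inv (p : Fin n) (x : T.Inv)
  | res (p : Fin n) (v : T.Res)

/-- The process of an event. -/
def Event.proc {n : ℕ} {T : DataType} : Event n T → Fin n
  | .inv p _ => p
  | .res p _ => p

/-- A finite or infinite history, written as a sequence with possible gaps: `H k = none` means
that `H` has no event at instant `k`. The history is the sequence of the events that are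
present, in the order of their instants. An operation is named by the instant of its
invocation. -/
def History (n : ℕ) (T : DataType) : Type := ℕ → Option (Event n T)

namespace History

variable {n : ℕ} {T : DataType}

/-- Operation `k` has the response event at instant `m`, with return value `v`: this is the next
event of the process that invoked the operation. -/
def IsResponse (H : History n T) (k m : ℕ) (v : T.Res) : Prop :=
  ∃ p x, H k = some (.inv p x) ∧ H m = some (.res p v) ∧ k < m ∧
    ∀ j, k < j → j < m → ∀ e, H j = some e → e.proc ≠ p

/-- For each process, the subsequence of its events is sequential: it starts with an invocation,
and invocations and matching responses alternate. -/
def WellFormed (H : History n T) : Prop :=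
  (∀ m p v, H m = some (.res p v) → ∃ k, H.IsResponse k m v) ∧
  (∀ k k' p x x', k < k' → H k = some (.inv p x) → H k' = some (.inv p x') →
    ∃ m v, m < k' ∧ H.IsResponse k m v)

/-- Instant `k` comes after the first `t` events of `H`, so that an event at instant `k` belongs
to the suffix `H_t`. -/
def InSuffix (H : History n T) (t k : ℕ) : Prop :=
  t ≤ Nat.count (fun j => (H j).isSome = true) k

/-- `S` is a legal sequential history with respect to `T` made of operations of `H`. The entry
`S i = some (k, v)` says that operation `k` is performed at position `i` and returns `v`
(positions may be left out; responses in `S` need not be those in `H`). No operation is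
performed twice, and the responses obey the sequential specification. -/
def IsLegalSequential (H : History n T) (S : ℕ → Option (ℕ × T.Res)) : Prop :=
  (∀ i j k v w, S i = some (k, v) → S j = some (k, w) → i = j) ∧
  ∃ σ : ℕ → T.State, σ 0 ∈ T.init ∧ ∀ i,
    (S i = none → σ (i + 1) = σ i) ∧
    (∀ k v, S i = some (k, v) → ∃ p x, H k = some (.inv p x) ∧ T.δ (σ i) x = (v, σ (i + 1)))

/-- Weak consistency: every completed operation `k` of a process `p` has an explanation, that is
a legal sequential history that contains only operations invoked before the response of `k`,
contains all operations of `p` that precede `k`, and ends with `k` and its actual response. -/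
def WeaklyConsistent (H : History n T) : Prop :=
  ∀ k m v, H.IsResponse k m v → ∃ S, H.IsLegalSequential S ∧
    (∀ i k' w, S i = some (k', w) → k' < m) ∧
    (∀ k' p x x', H k = some (.inv p x) → H k' = some (.inv p x') → k' < k →
      ∃ i w, S i = some (k', w)) ∧
    (∃ i, S i = some (k, v) ∧ ∀ j, i < j → S j = none)

/-- `S` is a `t`-linearization of `H`. -/
def IsTLinearization (H : History n T) (t : ℕ) (S : ℕ → Option (ℕ × T.Res)) : Prop :=
  H.IsLegalSequential S ∧
  (∀ k m v, H.IsResponse k m v → ∃ i w, S i = some (k, w)) ∧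
  (∀ k m v k', H.IsResponse k m v → m < k' → H.InSuffix t m → H.InSuffix t k' →
    ∀ i' w', S i' = some (k', w') → ∃ i w, i < i' ∧ S i = some (k, w)) ∧
  (∀ k m v, H.IsResponse k m v → H.InSuffix t m → ∃ i, S i = some (k, v))

/-- `t`-linearizability of a history. -/
def TLinearizable (H : History n T) (t : ℕ) : Prop :=
  H.WellFormed ∧ ∃ S, H.IsTLinearization t S

/-- Linearizability, which is `0`-linearizability. -/
def Linearizable (H : History n T) : Prop := H.TLinearizable 0

/-- Eventual linearizability. -/
def EventuallyLinearizable (H : History n T) : Prop :=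
  H.WeaklyConsistent ∧ ∃ t, H.TLinearizable t

end History

/-! ### Programs and their executions -/

/-- A program for `n` processes that implements an object of type `D` from registers (indexed by
`A`) and objects of type `T` (indexed by `B`). Each process has a local memory, which persists
between its operations. `start` is the local computation at the beginning of an operation,
`next` determines the next access to a base object or the return value of the operation, and
`resume` is the local computation after the response of a base object. All local computations
are Turing computable. -/
structure Program (n : ℕ) (A B : Type) [Primcodable A] [Primcodable B] (T D : DataType) where
  Mem : Type
  [codableMem : Primcodable Mem]
  regInit : A → ℕ
  objInit : B → T.State
  objInit_mem : ∀ b, objInit b ∈ T.init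
  memInit : Fin n → Mem
  start : Fin n → Mem → D.Inv → Mem
  next : Fin n → Mem → ((A × Register.Inv) ⊕ (B × T.Inv)) ⊕ D.Res
  resume : Fin n → Mem → Register.Res ⊕ T.Res → Mem
  computable_regInit : Computable regInit
  computable_start : ∀ p, Computable₂ (start p)
  computable_next : ∀ p, Computable (next p)
  computable_resume : ∀ p, Computable₂ (resume p)

attribute [instance] Program.codableMem

/-- Events of the whole system: an event at a register, at a base object of type `T`, or at the
implemented object. -/
inductive SysEvent (n : ℕ) (A B : Type) (T D : DataType) where
  | reg (a : A) (e : Event n Register)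
  | obj (b : B) (e : Event n T)
  | top (e : Event n D)

/-- The process of an event. -/
def SysEvent.proc {n : ℕ} {A B : Type} {T D : DataType} : SysEvent n A B T D → Fin n
  | .reg _ e => e.proc
  | .obj _ e => e.proc
  | .top e => e.proc

/-- A finite or infinite history of the whole system (again with possible gaps). -/
def SysHistory (n : ℕ) (A B : Type) (T D : DataType) : Type :=
  ℕ → Option (SysEvent n A B T D)

namespace SysHistory

variable {n : ℕ} {A B : Type} {T D : DataType}

open Classical in
/-- The events at register `a`, which is initialized to `s`. -/
noncomputable def atReg (ρ : SysHistory n A B T D) (a : A) (s : ℕ) :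
    History n (Register.initialized s) := fun k =>
  match ρ k with
  | some (.reg a' (.inv p x)) => if a' = a then some (.inv p x) else none
  | some (.reg a' (.res p v)) => if a' = a then some (.res p v) else none
  | _ => none

open Classical in
/-- The events at the base object `b`, which is initialized to `s`. -/
noncomputable def atObj (ρ : SysHistory n A B T D) (b : B) (s : T.State) :
    History n (T.initialized s) := fun k =>
  match ρ k with
  | some (.obj b' (.inv p x)) => if b' = b then some (.inv p x) else none
  | some (.obj b' (.res p v)) => if b' = b then some (.res p v) else none
  | _ => none

/-- The events at the implemented object. -/
def atTop (ρ : SysHistory n A B T D) : History n D := fun k =>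
  match ρ k with
  | some (.top e) => some e
  | _ => none

end SysHistory

/-- The phase of a process: between two operations, inside an operation and about to take its
next step, or waiting for the response of a register or of a base object. -/
inductive Phase (A B : Type) where
  | idle
  | running
  | waitReg (a : A)
  | waitObj (b : B)

namespace Program

variable {n : ℕ} {A B : Type} [Primcodable A] [Primcodable B] {T D : DataType}

/-- The steps that process `p` can take according to the program. -/
inductive LocalStep (P : Program n A B T D) (p : Fin n) :
    P.Mem × Phase A B → SysEvent n A B T D → P.Mem × Phase A B → Prop
  | invoke (m : P.Mem) (x : D.Inv) :
      LocalStep P p (m, .idle) (.top (.inv p x)) (P.start p m x, .running)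
  | callReg (m : P.Mem) (a : A) (x : Register.Inv) (h : P.next p m = .inl (.inl (a, x))) :
      LocalStep P p (m, .running) (.reg a (.inv p x)) (m, .waitReg a)
  | replyReg (m : P.Mem) (a : A) (v : Register.Res) :
      LocalStep P p (m, .waitReg a) (.reg a (.res p v)) (P.resume p m (.inl v), .running)
  | callObj (m : P.Mem) (b : B) (x : T.Inv) (h : P.next p m = .inl (.inr (b, x))) :
      LocalStep P p (m, .running) (.obj b (.inv p x)) (m, .waitObj b)
  | replyObj (m : P.Mem) (b : B) (v : T.Res) :
      LocalStep P p (m, .waitObj b) (.obj b (.res p v)) (P.resume p m (.inr v), .running)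
  | respond (m : P.Mem) (v : D.Res) (h : P.next p m = .inr v) :
      LocalStep P p (m, .running) (.top (.res p v)) (m, .idle)

/-- `ρ` is the history of an asynchronous execution in which every process follows the program;
nothing is assumed yet about the responses of the base objects. -/
def Follows (P : Program n A B T D) (ρ : SysHistory n A B T D) : Prop :=
  ∃ c : ℕ → Fin n → P.Mem × Phase A B,
    (∀ p, c 0 p = (P.memInit p, .idle)) ∧
    ∀ k, (ρ k = none → c (k + 1) = c k) ∧
      ∀ e, ρ k = some e →
        P.LocalStep e.proc (c k e.proc) e (c (k + 1) e.proc) ∧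
        ∀ q, q ≠ e.proc → c (k + 1) q = c k q

/-- `ρ` is an execution of the program with linearizable registers and eventually linearizable
base objects of type `T`. -/
def IsExecution (P : Program n A B T D) (ρ : SysHistory n A B T D) : Prop :=
  P.Follows ρ ∧
  (∀ a, (ρ.atReg a (P.regInit a)).Linearizable) ∧
  (∀ b, (ρ.atObj b (P.objInit b)).EventuallyLinearizable)

/-- Wait-freedom: a process that keeps taking steps completes each of its operations, regardless
of the other processes. -/
def WaitFree (P : Program n A B T D) : Prop :=
  ∀ ρ, P.IsExecution ρ → ∀ p k x, ρ.atTop k = some (.inv p x) →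
    (∀ N, ∃ j, N ≤ j ∧ ∃ e, ρ j = some e ∧ e.proc = p) →
    ∃ m v, ρ.atTop.IsResponse k m v

/-- The program is a wait-free eventually linearizable implementation of `D`. -/
def EventuallyImplements (P : Program n A B T D) : Prop :=
  P.WaitFree ∧ ∀ ρ, P.IsExecution ρ → ρ.atTop.EventuallyLinearizable

end Program

/-- The eventual consensus number of `T` (with fetch-and-cons over the values `V`): the largest
`n` for which eventually linearizable objects of type `T` and linearizable registers, as many as
wanted of each, can wait-free implement eventually linearizable `n`-process fetch-and-cons;
`⊤` if there is no largest `n`. -/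
noncomputable def eventualConsensusNumber (V : Type) [Primcodable V] (T : DataType) : ℕ∞ :=
  sSup {N : ℕ∞ | ∃ n : ℕ, N = n ∧
    ∃ P : Program n ℕ ℕ T (FetchAndCons V), P.EventuallyImplements}

end EventualLin

/-! A test-and-set history with finitely many winners is `t`-linearizable for large `t`: let the
first invoked operation win and all others lose. Weak consistency only asks that a process win with
no operation but its first, and that an operation lose only if another one was invoked before it
returns (`eventuallyLinearizable_testAndSet`). A register achieves this: read it, lose if it is
nonzero, otherwise write 1 and win.

By the same criterion, an object that answers True to the first access of each process and False
afterwards is eventually linearizable, although its answers depend on the caller alone. So an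
implementation of fetch-and-cons for two processes must also work when only registers carry
information between them.

Call an operation an anchor if it runs alone and its response has as many entries as operations were
invoked before it. If it lies in the linearized suffix, exactly those operations precede it in the
linearization, and the operation that comes next can be recognized by the length of its response
(`IsAnchor.exists_next`). When both processes are idle after the anchor, their first responses thus
tell each of them whose operation is next. This is two-process consensus, which a valency argument
excludes for registers (`Config.no_consensus`).

The bound `t` depends on the execution, so no single anchor is known to lie in the suffix. Therefore
an infinite execution is built in stages: each stage is extended to a later anchor
(`exists_anchored`) and then to a wrong decision in the race after it (`Anchored.exists_wrong`). The
limit is `t`-linearizable for some `t`, which contradicts `Anchored.not_wrong` at an anchor beyond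
`t`. One process can keep the list in its memory, so the number is exactly 1. -/

namespace EventualLin

namespace History

variable {n : ℕ} {T : DataType} {H : History n T}

/-! ### Responses and suffixes -/

theorem IsResponse.lt {k m : ℕ} {v : T.Res} (h : H.IsResponse k m v) : k < m := by
  obtain ⟨p, x, -, -, h, -⟩ := h
  exact h

theorem IsResponse.unique {k m m' : ℕ} {v v' : T.Res} (h : H.IsResponse k m v)
    (h' : H.IsResponse k m' v') : m = m' ∧ v = v' := by
  obtain ⟨p, x, h1, h2, h3, h4⟩ := h
  obtain ⟨p', x', h1', h2', h3', h4'⟩ := h'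
  obtain ⟨rfl, rfl⟩ : p = p' ∧ x = x' := by simpa [h1] using h1'
  obtain rfl : m = m' := by
    rcases lt_trichotomy m m' with h | h | h
    · exact absurd rfl (h4' m h3 h _ h2)
    · exact h
    · exact absurd rfl (h4 m' h3' h _ h2')
  exact ⟨rfl, by simpa [h2] using h2'⟩

theorem IsResponse.op_unique {k k' m : ℕ} {v v' : T.Res} (h : H.IsResponse k m v)
    (h' : H.IsResponse k' m v') : k = k' := by
  obtain ⟨p, x, h1, h2, h3, h4⟩ := h
  obtain ⟨p', x', h1', h2', h3', h4'⟩ := h'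
  obtain ⟨rfl, rfl⟩ : p = p' ∧ v = v' := by simpa [h2] using h2'
  rcases lt_trichotomy k k' with h | h | h
  · exact absurd rfl (h4 k' h h3' _ h1')
  · exact h
  · exact absurd rfl (h4' k h h3 _ h1)

theorem InSuffix.mono {t k k' : ℕ} (h : H.InSuffix t k) (hk : k ≤ k') : H.InSuffix t k' :=
  le_trans h (Nat.count_monotone _ hk)

theorem InSuffix.le {t k : ℕ} (h : H.InSuffix t k) : t ≤ k :=
  le_trans h (Nat.count_le _)

theorem inSuffix_zero (k : ℕ) : H.InSuffix 0 k := Nat.zero_le _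

/-- In a linearization, an operation comes before all operations that are invoked after its
response. -/
theorem IsTLinearization.lt_of_lt {t : ℕ} {S : ℕ → Option (ℕ × T.Res)}
    (hS : H.IsTLinearization t S) {k m k' i i' : ℕ} {v w w' : T.Res} (h : H.IsResponse k m v)
    (hm : m < k') (ht : H.InSuffix t m) (hi : S i = some (k, w)) (hi' : S i' = some (k', w')) :
    i < i' := by
  obtain ⟨j, u, hj, hju⟩ := hS.2.2.1 k m v k' h hm ht (ht.mono hm.le) i' w' hi'
  rwa [hS.1.1 i j k w u hi hju]

/-- Linearizable histories are weakly consistent. -/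
theorem Linearizable.weaklyConsistent (h : H.Linearizable) : H.WeaklyConsistent := by
  obtain ⟨hW, S, hS⟩ := h
  intro k m v hk
  obtain ⟨i, hi⟩ := hS.2.2.2 k m v hk (inSuffix_zero _)
  have hS' : ∀ j u, (if j ≤ i then S j else none) = some u → j ≤ i ∧ S j = some u := by
    intro j u hj
    by_cases hji : j ≤ i
    · exact ⟨hji, by simpa [hji] using hj⟩
    · simp [hji] at hj
  -- The explanation of `k` is the linearization cut off after the position of `k`. Real-time order
  -- keeps out the operations invoked after `m` and keeps in the earlier operations of the same
  -- process.
  refine ⟨fun j => if j ≤ i then S j else none, ⟨?_, ?_⟩, ?_, ?_, ?_⟩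
  · intro j j' k' u u' hj hj'
    exact hS.1.1 j j' k' u u' (hS' _ _ hj).2 (hS' _ _ hj').2
  · obtain ⟨σ, h0, hσ⟩ := hS.1.2
    refine ⟨fun j => if j ≤ i then σ j else σ (i + 1), by simpa using h0, fun j => ⟨?_, ?_⟩⟩
    · intro hj
      dsimp only at hj ⊢
      rcases lt_trichotomy j i with hji | rfl | hji
      · rw [if_pos hji.le] at hj
        rw [if_pos hji.le, if_pos (by omega)]
        exact (hσ j).1 hj
      · simp [hi] at hj
      · rw [if_neg (by omega), if_neg (by omega)]
    · intro k' u hj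
      obtain ⟨hji, hj⟩ := hS' _ _ hj
      obtain ⟨p, x, h1, h2⟩ := (hσ j).2 k' u hj
      refine ⟨p, x, h1, ?_⟩
      dsimp only
      rw [if_pos hji, h2]
      split_ifs with h
      · rfl
      · rw [show j = i by omega]
  · intro j k' w hj
    obtain ⟨hji, hj⟩ := hS' _ _ hj
    by_contra! hmk
    have hne : m ≠ k' := by
      rintro rfl
      obtain ⟨p, x, h1, -⟩ := hS.1.2.choose_spec.2 j |>.2 _ _ hj
      obtain ⟨p', x', -, h2, -⟩ := hk
      simp [h1] at h2
    have := hS.lt_of_lt hk (lt_of_le_of_ne hmk hne) (inSuffix_zero _) hi hj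
    omega
  · intro k' p x x' hx hx' hlt
    obtain ⟨m', v', hm', hr⟩ := hW.2 k' k p x' x hlt hx' hx
    obtain ⟨j, w, hj⟩ := hS.2.1 k' m' v' hr
    have := hS.lt_of_lt hr hm' (inSuffix_zero _) hj hi
    exact ⟨j, w, by simpa [this.le] using hj⟩
  · refine ⟨i, by simpa using hi, fun j hj => ?_⟩
    simp [not_le.mpr hj]

theorem Linearizable.eventuallyLinearizable (h : H.Linearizable) : H.EventuallyLinearizable :=
  ⟨h.weaklyConsistent, 0, h⟩

/-! ### Atomic histories -/

/-- If the two events of each operation take place at instants `2 * j` and `2 * j + 1`, then the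
history is well-formed. -/
theorem wellFormed_of_atomic
    (hH : ∀ j, (H (2 * j) = none ∧ H (2 * j + 1) = none) ∨
      ∃ p x v, H (2 * j) = some (.inv p x) ∧ H (2 * j + 1) = some (.res p v)) :
    H.WellFormed := by
  have key : ∀ j p x, H (2 * j) = some (.inv p x) → ∃ v, H.IsResponse (2 * j) (2 * j + 1) v := by
    intro j p x hj
    rcases hH j with h | ⟨q, y, v, h1, h2⟩
    · simp [h.1] at hj
    · exact ⟨v, q, y, h1, h2, by omega, fun i _ _ => by omega⟩
  have even : ∀ k p x, H k = some (.inv p x) → ∃ j, k = 2 * j := by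
    intro k p x hk
    rcases Nat.even_or_odd' k with ⟨j, rfl | rfl⟩
    · exact ⟨j, rfl⟩
    · rcases hH j with h | ⟨q, y, v, h1, h2⟩
      · simp [h.2] at hk
      · simp [h2] at hk
  refine ⟨fun m p v hm => ?_, fun k k' p x x' hlt hk hk' => ?_⟩
  · rcases Nat.even_or_odd' m with ⟨j, rfl | rfl⟩
    · rcases hH j with h | ⟨q, y, v, h1, h2⟩
      · simp [h.1] at hm
      · simp [h1] at hm
    · rcases hH j with h | ⟨q, y, w, h1, h2⟩
      · simp [h.2] at hm
      · obtain ⟨rfl, rfl⟩ : q = p ∧ w = v := by simpa [h2] using hm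
        exact ⟨2 * j, q, y, h1, h2, by omega, fun i _ _ => by omega⟩
  · obtain ⟨j, rfl⟩ := even k p x hk
    obtain ⟨j', rfl⟩ := even k' p x' hk'
    obtain ⟨v, hv⟩ := key j p x hk
    exact ⟨_, v, by omega, hv⟩

/-- A well-formed history is linearizable if the responses obey the sequential specification when
each operation is performed at the instant of its response. -/
theorem linearizable_of_response (hW : H.WellFormed) (σ : ℕ → T.State) (h0 : σ 0 ∈ T.init)
    (hnone : ∀ m, (∀ p v, H m ≠ some (.res p v)) → σ (m + 1) = σ m)
    (hres : ∀ k m v p x, H.IsResponse k m v → H k = some (.inv p x) →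
      T.δ (σ m) x = (v, σ (m + 1))) :
    H.Linearizable := by
  classical
  -- Position `m` holds the operation that responds at instant `m`; pending operations are left out.
  let S : ℕ → Option (ℕ × T.Res) := fun m =>
    if h : ∃ kv : ℕ × T.Res, H.IsResponse kv.1 m kv.2 then some h.choose else none
  have hS : ∀ m k v, S m = some (k, v) ↔ H.IsResponse k m v := by
    intro m k v
    by_cases h : ∃ kv : ℕ × T.Res, H.IsResponse kv.1 m kv.2
    · have h1 : S m = some h.choose := dif_pos h
      have h2 := h.choose_spec
      rw [h1]
      constructor
      · intro h3
        rw [Option.some.injEq] at h3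
        rwa [h3] at h2
      · intro h3
        have h4 : h.choose.1 = k := h2.op_unique h3
        rw [← h4] at h3
        rw [← h4, ← (h2.unique h3).2]
    · have h1 : S m = none := dif_neg h
      simp only [h1, reduceCtorEq, false_iff]
      exact fun h2 => h ⟨(k, v), h2⟩
  refine ⟨hW, S, ⟨?_, σ, h0, fun m => ⟨fun hm => hnone m fun p v h => ?_, ?_⟩⟩, ?_, ?_, ?_⟩
  · intro i j k v w hi hj
    exact (((hS _ _ _).mp hi).unique ((hS _ _ _).mp hj)).1
  · obtain ⟨k, hk⟩ := hW.1 m p v h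
    simp [(hS m k v).mpr hk] at hm
  · intro k v h
    have h := (hS _ _ _).mp h
    obtain ⟨p, x, hx, -⟩ := id h
    exact ⟨p, x, hx, hres k m v p x h hx⟩
  · intro k m v h
    exact ⟨m, v, (hS _ _ _).mpr h⟩
  · intro k m v k' h hm _ _ i' w' hi'
    have := ((hS _ _ _).mp hi').lt
    exact ⟨m, v, by omega, (hS _ _ _).mpr h⟩
  · intro k m v h _
    exact ⟨m, (hS _ _ _).mpr h⟩

/-- If the two events of each operation take place at instants `2 * j` and `2 * j + 1`, and the
responses obey the sequential specification, then the history is linearizable. -/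
theorem linearizable_of_atomic (σ : ℕ → T.State) (h0 : σ 0 ∈ T.init)
    (hH : ∀ j, (H (2 * j) = none ∧ H (2 * j + 1) = none ∧ σ (j + 1) = σ j) ∨
      ∃ p x v, H (2 * j) = some (.inv p x) ∧ H (2 * j + 1) = some (.res p v) ∧
        T.δ (σ j) x = (v, σ (j + 1))) :
    H.Linearizable := by
  have hW : H.WellFormed := wellFormed_of_atomic fun j => by
    rcases hH j with h | ⟨p, x, v, h1, h2, -⟩
    · exact .inl ⟨h.1, h.2.1⟩
    · exact .inr ⟨p, x, v, h1, h2⟩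
  -- Responses sit at odd instants, and `m / 2` increases exactly when such an instant is passed.
  refine linearizable_of_response hW (fun m => σ (m / 2)) (by simpa using h0) (fun m hm => ?_) ?_
  · rcases Nat.even_or_odd' m with ⟨j, rfl | rfl⟩
    · congr 1
      omega
    · rw [show (2 * j + 1 + 1) / 2 = j + 1 by omega, show (2 * j + 1) / 2 = j by omega]
      rcases hH j with h | ⟨p, x, v, -, h, -⟩
      · exact h.2.2
      · exact absurd h (hm p v)
  · intro k m v p x h hx
    obtain ⟨q, y, -, hm, -, -⟩ := id h
    rcases Nat.even_or_odd' m with ⟨j, rfl | rfl⟩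
    · rcases hH j with h' | ⟨_, _, _, h1, -, -⟩
      · simp [h'.1] at hm
      · simp [h1] at hm
    · rcases hH j with h' | ⟨r, z, w, h1, h2, h3⟩
      · simp [h'.2.1] at hm
      · have h' : H.IsResponse (2 * j) (2 * j + 1) w :=
          ⟨r, z, h1, h2, by omega, fun i _ _ => by omega⟩
        obtain rfl := h.op_unique h'
        obtain ⟨rfl, rfl⟩ : r = p ∧ z = x := by simpa [h1] using hx
        rw [show (2 * j + 1 + 1) / 2 = j + 1 by omega, show (2 * j + 1) / 2 = j by omega, h3,
          (h.unique h').2]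

/-! ### Test-and-set histories -/

/-- A test-and-set history is weakly consistent if a process can win only with its first
operation, and an operation can lose only if another operation was invoked before it returns. -/
theorem weaklyConsistent_testAndSet {H : History n TestAndSet}
    (hwin : ∀ k m k' p x x', H.IsResponse k m true → H k = some (.inv p x) →
      H k' = some (.inv p x') → k ≤ k')
    (hlose : ∀ k m, H.IsResponse k m false → ∃ k' p x, k' < m ∧ k' ≠ k ∧
      H k' = some (.inv p x)) :
    H.WeaklyConsistent := by
  classical
  intro k m v hr
  have hr' := hr
  obtain ⟨p, x, hk, hm, hkm, -⟩ := hr'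
  match v, hr with
  | true, hr =>
    -- A winner performed alone explains itself: by `hwin` its process has no earlier operation to
    -- include.
    refine ⟨fun i => if i = 0 then some (k, true) else none, ⟨?_, ?_⟩, ?_, ?_, ?_⟩
    · intro i j k' v w hi hj
      by_cases h0 : i = 0 <;> by_cases h1 : j = 0 <;> simp_all
    · refine ⟨fun i => decide (0 < i), by simp, fun i => ⟨?_, ?_⟩⟩
      · intro hi
        by_cases h0 : i = 0
        · simp [h0] at hi
        · simp; omega
      · intro k' v hi
        by_cases h0 : i = 0
        · simp only [h0, if_true, Option.some.injEq, Prod.mk.injEq] at hi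
          obtain ⟨rfl, rfl⟩ := hi
          exact ⟨p, x, hk, by simp [h0]⟩
        · simp [h0] at hi
    · intro i k' w hi
      by_cases h0 : i = 0
      · simp only [h0, if_true, Option.some.injEq, Prod.mk.injEq] at hi
        omega
      · simp [h0] at hi
    · intro k' q y y' hy hy' hlt
      have := hwin k m k' q y y' hr hy hy'
      omega
    · exact ⟨0, by simp, fun j hj => by simp; omega⟩
  | false, hr =>
    -- A loser is preceded by all other operations invoked before `m`, each placed at its invocation
    -- instant; the first of them takes the bit. Position `m` is left for `k`.
    let I : ℕ → Prop := fun i => i < m ∧ i ≠ k ∧ ∃ p x, H i = some (.inv p x)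
    have hI : ∃ i, I i := by
      obtain ⟨k', q, y, h1, h2, h3⟩ := hlose k m hr
      exact ⟨k', h1, h2, q, y, h3⟩
    let S : ℕ → Option (ℕ × Bool) := fun i =>
      if I i then some (i, !decide (∃ j < i, I j)) else if i = m then some (k, false) else none
    have hSI : ∀ i, I i → S i = some (i, !decide (∃ j < i, I j)) := fun i hi => if_pos hi
    have hSm : S m = some (k, false) := by
      have : ¬ I m := fun h => lt_irrefl _ h.1
      simp only [S, if_neg this, if_true]
    have hSn : ∀ i, ¬ I i → i ≠ m → S i = none := fun i h1 h2 => by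
      simp only [S, if_neg h1, if_neg h2]
    have hS : ∀ i k' w, S i = some (k', w) → (I i ∧ k' = i ∧ w = !decide (∃ j < i, I j)) ∨
        (i = m ∧ k' = k ∧ w = false) := by
      intro i k' w h
      by_cases h1 : I i
      · rw [hSI i h1] at h
        simp only [Option.some.injEq, Prod.mk.injEq] at h
        exact .inl ⟨h1, h.1.symm, h.2.symm⟩
      · by_cases h2 : i = m
        · subst h2
          rw [hSm] at h
          simp only [Option.some.injEq, Prod.mk.injEq] at h
          exact .inr ⟨rfl, h.1.symm, h.2.symm⟩
        · simp [hSn i h1 h2] at h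
    refine ⟨S, ⟨?_, ?_⟩, ?_, ?_, ?_⟩
    · intro i j k' v w hi hj
      rcases hS _ _ _ hi with ⟨h1, h2, -⟩ | ⟨h1, h2, -⟩ <;>
        rcases hS _ _ _ hj with ⟨h3, h4, -⟩ | ⟨h3, h4, -⟩
      · omega
      · exact absurd (h2.symm.trans h4) h1.2.1
      · exact absurd (h4.symm.trans h2) h3.2.1
      · omega
    · refine ⟨fun i => decide (∃ j < i, I j), by simp, fun i => ⟨?_, ?_⟩⟩
      · intro hi
        have hIi : ¬ I i := fun h => by simp [hSI i h] at hi
        simp only [decide_eq_decide]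
        constructor
        · rintro ⟨j, hj, hIj⟩
          refine ⟨j, lt_of_le_of_ne (by omega) ?_, hIj⟩
          rintro rfl
          exact hIi hIj
        · rintro ⟨j, hj, hIj⟩
          exact ⟨j, by omega, hIj⟩
      · intro k' w hi
        rcases hS _ _ _ hi with ⟨h1, rfl, rfl⟩ | ⟨rfl, rfl, rfl⟩
        · obtain ⟨q, y, hq⟩ := h1.2.2
          refine ⟨q, y, hq, ?_⟩
          have : ∃ j < k' + 1, I j := ⟨k', by omega, h1⟩
          exact Prod.ext rfl (decide_eq_true this).symm
        · refine ⟨p, x, hk, ?_⟩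
          obtain ⟨j, hj⟩ := hI
          have h1 : ∃ j < i, I j := ⟨j, hj.1, hj⟩
          have h2 : ∃ j < i + 1, I j := ⟨j, by have := hj.1; omega, hj⟩
          simp only [h1, h2, decide_true, Bool.not_true]
    · intro i k' w hi
      rcases hS _ _ _ hi with ⟨h1, rfl, -⟩ | ⟨-, rfl, -⟩
      · exact h1.1
      · exact hkm
    · intro k' q y y' hy hy' hlt
      exact ⟨k', _, hSI k' ⟨by omega, by omega, q, y', hy'⟩⟩
    · exact ⟨m, hSm, fun j hj => hSn j (fun h => by have := h.1; omega) (by omega)⟩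

/-- A well-formed test-and-set history is `t`-linearizable for some `t` if a process can win only
with its first operation. -/
theorem tLinearizable_testAndSet {H : History n TestAndSet} (hW : H.WellFormed)
    (hwin : ∀ k m k' p x x', H.IsResponse k m true → H k = some (.inv p x) →
      H k' = some (.inv p x') → k ≤ k') :
    ∃ t, H.TLinearizable t := by
  classical
  by_cases hinv : ∃ k p x, H k = some (.inv p x)
  swap
  · refine ⟨0, hW, fun _ => none, ⟨by simp, fun _ => false, by simp, by simp⟩, ?_, by simp, ?_⟩ <;>
    · rintro k m v ⟨p, x, h, -⟩
      exact absurd ⟨k, p, x, h⟩ hinv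
  -- No operation responds before `o` is invoked, so `o` may be linearized as the winner, whatever
  -- it returned in the history.
  obtain ⟨o, ⟨po, xo, ho⟩, hmin⟩ : ∃ o, (∃ p x, H o = some (.inv p x)) ∧
      ∀ k p x, H k = some (.inv p x) → o ≤ k :=
    ⟨Nat.find hinv, Nat.find_spec hinv, fun k p x h => Nat.find_min' hinv ⟨p, x, h⟩⟩
  -- By `hwin` a process wins at most once, so its wins are bounded in time; there are finitely many
  -- processes.
  have hbound : ∀ p, ∃ N, ∀ k m x, H.IsResponse k m true → H k = some (.inv p x) → m < N := by
    intro p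
    by_cases h : ∃ k m x, H.IsResponse k m true ∧ H k = some (.inv p x)
    · obtain ⟨k, m, x, h1, h2⟩ := h
      refine ⟨m + 1, fun k' m' x' h1' h2' => ?_⟩
      have := hwin k m k' p x x' h1 h2 h2'
      have := hwin k' m' k p x' x h1' h2' h2
      obtain rfl : k = k' := by omega
      have := (h1.unique h1').1
      omega
    · push Not at h
      exact ⟨0, fun k m x h1 h2 => absurd h2 (h k m x h1)⟩
  choose N hN using hbound
  obtain ⟨M, hM⟩ : ∃ M, ∀ m v, H.IsResponse o m v → m < M := by
    by_cases h : ∃ m v, H.IsResponse o m v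
    · obtain ⟨m, v, h⟩ := h
      exact ⟨m + 1, fun m' v' h' => by have := (h.unique h').1; omega⟩
    · exact ⟨0, fun m v h' => absurd ⟨m, v, h'⟩ h⟩
  -- An instant in the suffix is at least `t`, so every response there is a loss of an operation
  -- other than `o`.
  obtain ⟨t, ht, htM⟩ : ∃ t, (∀ p, N p ≤ t) ∧ M ≤ t :=
    ⟨Finset.univ.sup N + M, fun p => by
      have := Finset.le_sup (f := N) (Finset.mem_univ p); omega, by omega⟩
  let R : ℕ → ℕ → Prop := fun m k => k ≠ o ∧ ∃ v, H.IsResponse k m v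
  -- Position `0` is the win of `o`; the other completed operations lose, in the order of their
  -- responses, shifted by one.
  let S : ℕ → Option (ℕ × Bool) := fun i =>
    if i = 0 then some (o, true)
    else if h : ∃ k, R (i - 1) k then some (h.choose, false) else none
  have hS0 : S 0 = some (o, true) := by simp [S]
  have hS1 : ∀ m k, R m k → S (m + 1) = some (k, false) := by
    intro m k hR
    have hex : ∃ k, R (m + 1 - 1) k := ⟨k, hR⟩
    have h1 : S (m + 1) = some (hex.choose, false) := by
      simp only [S, if_neg (Nat.succ_ne_zero m), dif_pos hex]
    rw [h1]
    obtain ⟨-, v, hv⟩ := hex.choose_spec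
    obtain ⟨-, w, hw⟩ := hR
    rw [hv.op_unique hw]
  have hS : ∀ i k w, S i = some (k, w) → (i = 0 ∧ k = o ∧ w = true) ∨
      ∃ m, i = m + 1 ∧ R m k ∧ w = false := by
    intro i k w h
    rcases i with _ | m
    · rw [hS0] at h
      simp only [Option.some.injEq, Prod.mk.injEq] at h
      exact .inl ⟨rfl, h.1.symm, h.2.symm⟩
    · by_cases hex : ∃ k, R m k
      · obtain ⟨k', hk'⟩ := hex
        rw [hS1 m k' hk'] at h
        simp only [Option.some.injEq, Prod.mk.injEq] at h
        obtain ⟨rfl, rfl⟩ := h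
        exact .inr ⟨m, rfl, hk', rfl⟩
      · simp [S, hex] at h
  refine ⟨t, hW, S, ⟨?_, ?_⟩, ?_, ?_, ?_⟩
  · intro i j k v w hi hj
    rcases hS _ _ _ hi with ⟨h1, h2, -⟩ | ⟨m, h1, h2, -⟩ <;>
      rcases hS _ _ _ hj with ⟨h3, h4, -⟩ | ⟨m', h3, h4, -⟩
    · omega
    · exact absurd h2 h4.1
    · exact absurd h4 h2.1
    · obtain ⟨-, u, hu⟩ := h2
      obtain ⟨-, u', hu'⟩ := h4
      have := (hu.unique hu').1
      omega
  · refine ⟨fun i => decide (0 < i), by simp, fun i => ⟨?_, ?_⟩⟩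
    · intro hi
      have : i ≠ 0 := by
        rintro rfl
        simp [hS0] at hi
      simp; omega
    · intro k w hi
      rcases hS _ _ _ hi with ⟨rfl, rfl, rfl⟩ | ⟨m, rfl, ⟨-, v, q, y, hq, -⟩, rfl⟩
      · exact ⟨po, xo, ho, by simp⟩
      · exact ⟨q, y, hq, by simp⟩
  · intro k m v hr
    by_cases hk : k = o
    · exact ⟨0, true, by rw [hS0, hk]⟩
    · exact ⟨m + 1, false, hS1 m k ⟨hk, v, hr⟩⟩
  · intro k m v k' hr hm _ _ i' w' hi'
    rcases hS _ _ _ hi' with ⟨rfl, rfl, rfl⟩ | ⟨m', rfl, ⟨-, v', hr'⟩, rfl⟩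
    · obtain ⟨p, x, hp, -⟩ := id hr
      have := hmin k p x hp
      have := hr.lt
      omega
    · have := hr'.lt
      by_cases hk : k = o
      · exact ⟨0, true, by omega, by rw [hS0, hk]⟩
      · exact ⟨m + 1, false, by omega, hS1 m k ⟨hk, v, hr⟩⟩
  · intro k m v hr hm
    have hm := hm.le
    have hko : k ≠ o := by
      rintro rfl
      have := hM m v hr
      omega
    cases v with
    | true =>
      obtain ⟨p, x, hp, -⟩ := id hr
      have := hN p k m x hr hp
      have := ht p
      omega
    | false => exact ⟨m + 1, hS1 m k ⟨hko, false, hr⟩⟩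

theorem eventuallyLinearizable_testAndSet {H : History n TestAndSet} (hW : H.WellFormed)
    (hwin : ∀ k m k' p x x', H.IsResponse k m true → H k = some (.inv p x) →
      H k' = some (.inv p x') → k ≤ k')
    (hlose : ∀ k m, H.IsResponse k m false → ∃ k' p x, k' < m ∧ k' ≠ k ∧
      H k' = some (.inv p x)) :
    H.EventuallyLinearizable :=
  ⟨weaklyConsistent_testAndSet hwin hlose, tLinearizable_testAndSet hW hwin⟩

end History

end EventualLin

namespace EventualLin

/-! ### Two processes cannot reach consensus with registers -/

/-- The next step of a process with local states in `L`: a local step, a read of register `a`, or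
a write of `v` to register `a`. -/
inductive Action (L : Type) where
  | loc (l : L)
  | read (a : ℕ) (f : ℕ → L)
  | write (a v : ℕ) (l : L)

/-- A configuration of two processes: their local states and the values of the registers. -/
structure Config (L : Type) where
  loc : Bool → L
  reg : ℕ → ℕ

namespace Config

variable {L : Type}

/-- The local state of a process that performs an action. -/
def result (reg : ℕ → ℕ) : Action L → L
  | .loc l => l
  | .read a f => f (reg a)
  | .write _ _ l => l

/-- The registers after an action. -/
def update (reg : ℕ → ℕ) : Action L → ℕ → ℕ
  | .write a v _ => Function.update reg a v
  | _ => reg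

/-- The configuration after a step of process `b`. -/
def step (act : Bool → L → Action L) (b : Bool) (C : Config L) : Config L where
  loc := Function.update C.loc b (result C.reg (act b (C.loc b)))
  reg := update C.reg (act b (C.loc b))

/-- The configuration after `k` steps under the schedule `s`. -/
def run (act : Bool → L → Action L) (C : Config L) (s : ℕ → Bool) : ℕ → Config L
  | 0 => C
  | k + 1 => (run act C s k).step act (s k)

variable {act : Bool → L → Action L}

theorem step_loc_of_ne {b d : Bool} (h : d ≠ b) (C : Config L) :
    (C.step act b).loc d = C.loc d := by simp [step, h]

theorem run_congr {C : Config L} {s s' : ℕ → Bool} {k : ℕ} (h : ∀ i < k, s i = s' i) :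
    run act C s k = run act C s' k := by
  induction k with
  | zero => rfl
  | succ k ih => rw [run, run, ih fun i hi => h i (by omega), h k (by omega)]

theorem run_add (C : Config L) (s : ℕ → Bool) (k j : ℕ) :
    run act C s (k + j) = run act (run act C s k) (fun i => s (k + i)) j := by
  induction j with
  | zero => rfl
  | succ j ih => rw [← add_assoc, run, run, ih]

/-- `C'` can be reached from `C`. -/
def Reach (act : Bool → L → Action L) : Config L → Config L → Prop :=
  Relation.ReflTransGen fun C C' => ∃ b, C' = C.step act b

theorem Reach.exists_run {C C' : Config L} (h : Reach act C C') :
    ∃ s k, C' = run act C s k := by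
  induction h with
  | refl => exact ⟨fun _ => true, 0, rfl⟩
  | tail _ h ih =>
    obtain ⟨s, k, rfl⟩ := ih
    obtain ⟨b, rfl⟩ := h
    refine ⟨Function.update s k b, k + 1, ?_⟩
    rw [run, run_congr (s := s) (s' := Function.update s k b) fun i hi => ?_]
    · simp
    · simp [hi.ne]

theorem reach_run (C : Config L) (s : ℕ → Bool) (k : ℕ) : Reach act C (run act C s k) := by
  induction k with
  | zero => exact .refl
  | succ k ih => exact ih.tail ⟨s k, rfl⟩

theorem reach_step (C : Config L) (b : Bool) : Reach act C (C.step act b) :=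
  .single ⟨b, rfl⟩

/-- A solo run depends only on the local state of the process and on the registers. -/
theorem run_solo_congr {C C' : Config L} {d : Bool} (hl : C.loc d = C'.loc d)
    (hr : C.reg = C'.reg) (k : ℕ) :
    (run act C (fun _ => d) k).loc d = (run act C' (fun _ => d) k).loc d ∧
      (run act C (fun _ => d) k).reg = (run act C' (fun _ => d) k).reg := by
  induction k with
  | zero => exact ⟨hl, hr⟩
  | succ k ih => simp [run, step, ih.1, ih.2]

/-- For all steps of the two processes there is a process `d` that cannot distinguish a
configuration reached if process `true` moves first from one reached if process `false` moves
first. -/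
theorem exists_indistinguishable (C : Config L) :
    ∃ C₁ C₂ d, Reach act (C.step act true) C₁ ∧ Reach act (C.step act false) C₂ ∧
      C₁.loc d = C₂.loc d ∧ C₁.reg = C₂.reg := by
  -- If both orders give the same registers and the step of `true` does not affect the outcome of
  -- the step of `false`, then `false` cannot tell the orders apart.
  have comm : ((C.step act true).step act false).reg = ((C.step act false).step act true).reg →
      result C.reg (act false (C.loc false)) =
        result (update C.reg (act true (C.loc true))) (act false (C.loc false)) →
      ∃ C₁ C₂ d, Reach act (C.step act true) C₁ ∧ Reach act (C.step act false) C₂ ∧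
        C₁.loc d = C₂.loc d ∧ C₁.reg = C₂.reg := fun hr hl =>
    ⟨_, _, false, reach_step _ false, reach_step _ true, by simp [step, hl], hr⟩
  cases ht : act true (C.loc true) with
  | loc l => exact comm (by simp [step, ht, update]) (by simp [ht, update])
  -- A read leaves the registers alone, so `false` cannot tell whether `true` has read before it.
  | read a f =>
    exact ⟨_, _, false, reach_step _ false, .refl, by simp [step, ht, update],
      by simp [step, ht, update]⟩
  | write a v l =>
    cases hf : act false (C.loc false) with
    | loc l' =>
      exact comm (by simp [step, ht, hf, update]) (by simp [hf, result])
    | read a' f =>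
      exact ⟨_, _, true, .refl, reach_step _ true, by simp [step, ht, hf, update, result],
        by simp [step, ht, hf, update]⟩
    | write a' v' l' =>
      -- A write of `false` to the same register wipes out the write of `true`; writes to different
      -- registers commute.
      by_cases h : a = a'
      · subst h
        exact ⟨_, _, false, reach_step _ false, .refl, by simp [step, hf, result],
          by simp [step, hf, ht, update]⟩
      · refine comm ?_ (by simp [hf, result])
        simp [step, ht, hf, update, Function.update_comm h]

/-- With registers there is no wait-free consensus protocol for two processes whose inputs are
their own names. -/
theorem no_consensus (C : Config L) (dec : Bool → L → Option Bool)
    (stable : ∀ (C' : Config L) b b' w, dec b (C'.loc b) = some w →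
      dec b ((C'.step act b').loc b) = some w)
    (agree : ∀ s k w w', dec false ((run act C s k).loc false) = some w →
      dec true ((run act C s k).loc true) = some w' → w = w')
    (waitFree : ∀ s b, (∀ N, ∃ k, N ≤ k ∧ s k = b) →
      ∃ k w, dec b ((run act C s k).loc b) = some w)
    (solo : ∀ b k w, dec b ((run act C (fun _ => b) k).loc b) = some w → w = b) : False := by
  have stable' : ∀ {C₁ C₂ : Config L}, Reach act C₁ C₂ → ∀ {b w},
      dec b (C₁.loc b) = some w → dec b (C₂.loc b) = some w := by
    intro C₁ C₂ h b w hb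
    induction h with
    | refl => exact hb
    | tail _ h ih =>
      obtain ⟨b', rfl⟩ := h
      exact stable _ _ _ _ ih
  have agree' : ∀ {C₁ : Config L}, Reach act C C₁ → ∀ {b b' w w'},
      dec b (C₁.loc b) = some w → dec b' (C₁.loc b') = some w' → w = w' := by
    intro C₁ h b b' w w' hb hb'
    obtain ⟨s, k, rfl⟩ := h.exists_run
    cases b <;> cases b'
    · simpa [hb] using hb'
    · exact agree s k w w' hb hb'
    · exact (agree s k w' w hb' hb).symm
    · simpa [hb] using hb'
  have soloDec : ∀ {C₁ : Config L}, Reach act C C₁ → ∀ d,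
      ∃ k w, dec d ((run act C₁ (fun _ => d) k).loc d) = some w := by
    intro C₁ h d
    obtain ⟨s, j, rfl⟩ := h.exists_run
    obtain ⟨k, w, hk⟩ := waitFree (fun i => if i < j then s i else d) d
      fun N => ⟨N + j, by omega, by simp⟩
    refine ⟨k, w, ?_⟩
    have h3 : dec d ((run act C (fun i => if i < j then s i else d) (k + j)).loc d) = some w := by
      rw [run_add]
      exact stable' (reach_run _ _ j) hk
    rw [add_comm, run_add] at h3
    simpa [run_congr (s := fun i => if i < j then s i else d) (s' := s) (k := j) (act := act)
      (C := C) fun i hi => if_pos hi] using h3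
  -- The valency of a configuration; it is bivalent if both values are still possible.
  let Val : Config L → Bool → Prop := fun C₁ x =>
    ∃ C₂, Reach act C₁ C₂ ∧ ∃ b, dec b (C₂.loc b) = some x
  have val_of_dec : ∀ {C₁ : Config L}, Reach act C C₁ → ∀ {b w x},
      dec b (C₁.loc b) = some w → Val C₁ x → x = w := by
    rintro C₁ h b w x hb ⟨C₂, h2, b', hb'⟩
    exact agree' (h.trans h2) hb' (stable' h2 hb)
  have val_step : ∀ {C₁ : Config L}, Reach act C C₁ → (∀ x, Val C₁ x) →
      ∀ x, ∃ b, Val (C₁.step act b) x := by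
    intro C₁ h hbi x
    obtain ⟨C₂, h2, b, hb⟩ := hbi x
    rcases Relation.ReflTransGen.cases_head h2 with rfl | ⟨C₃, ⟨b', rfl⟩, h3⟩
    · have := val_of_dec h hb (hbi (!x))
      cases x <;> simp at this
    · exact ⟨b', C₂, h3, b, hb⟩
  -- A critical configuration: bivalent without bivalent successors. Solo runs make `C` bivalent. If
  -- bivalence could always be preserved, there would be an infinite bivalent run; a process that
  -- moves infinitely often in it decides, and this ends bivalence.
  obtain ⟨C₁, h1, hbi, hcrit⟩ : ∃ C₁, Reach act C C₁ ∧ (∀ x, Val C₁ x) ∧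
      ∀ b, ¬ ∀ x, Val (C₁.step act b) x := by
    by_contra! hno
    have h0 : ∀ x, Val C x := fun x => by
      obtain ⟨k, w, hw⟩ := soloDec .refl x
      obtain rfl := solo x k w hw
      exact ⟨_, reach_run _ _ k, w, hw⟩
    let B := {C₁ : Config L // Reach act C C₁ ∧ ∀ x, Val C₁ x}
    choose! f hf using hno
    let next : B → B := fun D =>
      ⟨D.1.step act (f D.1), D.2.1.tail ⟨_, rfl⟩, hf D.1 D.2.1 D.2.2⟩
    let D : ℕ → B := fun k => next^[k] ⟨C, .refl, h0⟩
    let s : ℕ → Bool := fun k => f (D k).1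
    have hD : ∀ k, run act C s k = (D k).1 := by
      intro k
      induction k with
      | zero => rfl
      | succ k ih =>
        have : D (k + 1) = next (D k) := Function.iterate_succ_apply' next k _
        rw [run, ih, this]
    obtain ⟨b, hb⟩ : ∃ b, ∀ N, ∃ k, N ≤ k ∧ s k = b := by
      by_contra! hcon
      obtain ⟨N, hN⟩ := hcon false
      obtain ⟨N', hN'⟩ := hcon true
      cases h : s (N + N')
      · exact hN (N + N') (by omega) h
      · exact hN' (N + N') (by omega) h
    obtain ⟨k, w, hk⟩ := waitFree s b hb
    rw [hD] at hk
    have := val_of_dec (D k).2.1 hk ((D k).2.2 (!w))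
    cases w <;> simp at this
  -- Each successor has a single possible value; both values come from some successor, so the two
  -- differ.
  have huniv : ∃ y, (∀ x, Val (C₁.step act true) x → x = y) ∧
      ∀ x, Val (C₁.step act false) x → x = !y := by
    have hst := val_step h1 hbi
    have key : ∀ b x x', Val (C₁.step act b) x → Val (C₁.step act b) x' → x = x' := by
      intro b x x' hx hx'
      by_contra hne
      refine hcrit b fun z => ?_
      rcases Bool.eq_or_eq_not z x with rfl | rfl
      · exact hx
      · have : x' = !x := Bool.eq_not_of_ne (Ne.symm hne)
        rwa [this] at hx'
    obtain ⟨b, hb⟩ := hst true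
    obtain ⟨b', hb'⟩ := hst false
    cases b <;> cases b'
    · exact absurd (key _ _ _ hb hb') (by simp)
    · exact ⟨false, fun x hx => key _ _ _ hx hb', fun x hx => key _ _ _ hx hb⟩
    · exact ⟨true, fun x hx => key _ _ _ hx hb, fun x hx => key _ _ _ hx hb'⟩
    · exact absurd (key _ _ _ hb hb') (by simp)
  obtain ⟨y, hy, hy'⟩ := huniv
  obtain ⟨D, D', d, hD, hD', hl, hr⟩ := exists_indistinguishable (act := act) C₁
  -- Running alone, `d` decides alike in the two configurations that it cannot distinguish, although
  -- their valencies are opposite.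
  obtain ⟨k, w, hw⟩ := soloDec ((h1.tail ⟨_, rfl⟩).trans hD) d
  have hw' := hw
  rw [(run_solo_congr hl hr k).1] at hw'
  have e1 := hy w ⟨_, hD.trans (reach_run _ _ k), d, hw⟩
  have e2 := hy' w ⟨_, hD'.trans (reach_run _ _ k), d, hw'⟩
  rw [e1] at e2
  cases y <;> simp at e2

end Config

end EventualLin

namespace EventualLin

namespace History

variable {n : ℕ} {V : Type} [Primcodable V]

/-! ### Fetch-and-cons histories -/

/-- The operations that `S` performs before position `i`. -/
def opsBefore {α : Type} (S : ℕ → Option (ℕ × α)) (i : ℕ) : Finset ℕ :=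
  -- The default `0` is never used: the filter keeps only occupied positions.
  ((Finset.range i).filter fun j => (S j).isSome).image fun j => ((S j).map Prod.fst).getD 0

theorem mem_opsBefore {α : Type} {S : ℕ → Option (ℕ × α)} {i k : ℕ} :
    k ∈ opsBefore S i ↔ ∃ j < i, ∃ v, S j = some (k, v) := by
  simp only [opsBefore, Finset.mem_image, Finset.mem_filter, Finset.mem_range]
  constructor
  · rintro ⟨j, ⟨hj, hs⟩, rfl⟩
    obtain ⟨⟨k, v⟩, h⟩ := Option.isSome_iff_exists.mp hs
    exact ⟨j, hj, v, by simp [h]⟩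
  · rintro ⟨j, hj, v, h⟩
    exact ⟨j, ⟨hj, by simp [h]⟩, by simp [h]⟩

open Classical in
/-- The operations that are invoked before instant `a`. -/
noncomputable def invsBefore {T : DataType} (H : History n T) (a : ℕ) : Finset ℕ :=
  (Finset.range a).filter fun k => ∃ p x, H k = some (.inv p x)

theorem mem_invsBefore {T : DataType} {H : History n T} {a k : ℕ} :
    k ∈ H.invsBefore a ↔ k < a ∧ ∃ p x, H k = some (.inv p x) := by
  simp [invsBefore]

/-- Invocations are events, so enough of them before `a` push `a` into the suffix. For an anchor
their number is the length of its response. -/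
theorem inSuffix_of_le_card {T : DataType} {H : History n T} {t a : ℕ}
    (h : t ≤ (H.invsBefore a).card) : H.InSuffix t a := by
  refine h.trans ?_
  rw [Nat.count_eq_card_filter_range]
  refine Finset.card_le_card fun k hk => ?_
  obtain ⟨h1, p, x, h2⟩ := mem_invsBefore.mp hk
  simp [h1, h2]

variable {H : History n (FetchAndCons V)} {S : ℕ → Option (ℕ × List V)}

/-- In a legal sequential history each response is a list whose length is the number of the
preceding operations. -/
theorem IsLegalSequential.length_eq (hS : H.IsLegalSequential S) {i k : ℕ} {L : List V}
    (hi : S i = some (k, L)) : L.length = (opsBefore S i).card := by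
  obtain ⟨hinj, σ, h0, hσ⟩ := hS
  have key : ∀ i, (σ i).length = (opsBefore S i).card := by
    intro i
    induction i with
    | zero =>
      have h0 : σ 0 = [] := h0
      simp [h0, opsBefore]
    | succ i ih =>
      cases hi : S i with
      | none =>
        rw [(hσ i).1 hi, ih]
        congr 1
        ext k
        simp only [mem_opsBefore]
        constructor
        · rintro ⟨j, hj, h⟩
          exact ⟨j, by omega, h⟩
        · rintro ⟨j, hj, v, h⟩
          refine ⟨j, lt_of_le_of_ne (by omega) ?_, v, h⟩
          rintro rfl
          simp [hi] at h
      | some kv =>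
        obtain ⟨k, v⟩ := kv
        obtain ⟨p, x, -, hδ⟩ := (hσ i).2 k v hi
        have h1 : σ (i + 1) = x :: σ i := (congrArg Prod.snd hδ).symm
        have h2 : opsBefore S (i + 1) = insert k (opsBefore S i) := by
          ext k'
          simp only [mem_opsBefore, Finset.mem_insert]
          constructor
          · rintro ⟨j, hj, w, h⟩
            rcases Nat.lt_succ_iff_lt_or_eq.mp hj with hj | rfl
            · exact .inr ⟨j, hj, w, h⟩
            · simp only [hi, Option.some.injEq, Prod.mk.injEq] at h
              exact .inl h.1.symm
          · rintro (rfl | ⟨j, hj, w, h⟩)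
            · exact ⟨i, by omega, v, hi⟩
            · exact ⟨j, by omega, w, h⟩
        have h3 : k ∉ opsBefore S i := by
          rw [mem_opsBefore]
          rintro ⟨j, hj, w, h⟩
          have := hinj i j k v w hi h
          omega
        rw [h1, h2, Finset.card_insert_of_notMem h3, List.length_cons, ih]
  obtain ⟨p, x, -, hδ⟩ := (hσ i).2 k L hi
  have h1 : σ i = L := congrArg Prod.fst hδ
  rw [← h1, key]

/-- Operation `a` runs without interference until it gets the response `L` at instant `e`, and
`L` has the length that the number of the operations invoked before `a` suggests. -/
structure IsAnchor (H : History n (FetchAndCons V)) (a e : ℕ) (L : List V) : Prop where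
  resp : H.IsResponse a e L
  alone : ∀ k p x, a < k → k < e → H k ≠ some (.inv p x)
  length : L.length = (H.invsBefore a).card

/-- If `a` is an anchor in the suffix that has been linearized, then all operations invoked
earlier are linearized before `a`, and so there is a unique operation that is the next one. -/
theorem IsAnchor.exists_next {a e t : ℕ} {L : List V} (hA : H.IsAnchor a e L)
    (hS : H.IsTLinearization t S) (ht : H.InSuffix t a) {k m : ℕ} {L' : List V}
    (hk : H.IsResponse k m L') (hek : e < k) :
    ∃ k', e < k' ∧ (∃ p x, H k' = some (.inv p x)) ∧
      ∀ k₁ m₁ L₁, H.IsResponse k₁ m₁ L₁ → e < k₁ →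
        k' < m₁ ∧ (L₁.length = L.length + 1 ↔ k₁ = k') := by
  have hae := hA.resp.lt
  obtain ⟨i₀, hi₀⟩ := hS.2.2.2 a e L hA.resp (ht.mono hae.le)
  have hinv : ∀ j k v, S j = some (k, v) → ∃ p x, H k = some (.inv p x) := by
    intro j k v hj
    obtain ⟨σ, -, hσ⟩ := hS.1.2
    obtain ⟨p, x, h, -⟩ := (hσ j).2 k v hj
    exact ⟨p, x, h⟩
  have hne : ∀ j k v, S j = some (k, v) → k ≠ e := by
    rintro j k v hj rfl
    obtain ⟨p, x, h⟩ := hinv j k v hj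
    obtain ⟨q, y, -, h', -⟩ := hA.resp
    simp [h] at h'
  -- Since `a` runs alone, an operation invoked after `a` is invoked after the response at `e`, and
  -- real-time order puts it behind `a`.
  have hsub : opsBefore S i₀ ⊆ H.invsBefore a := by
    intro k hk
    obtain ⟨j, hj, v, hjk⟩ := mem_opsBefore.mp hk
    obtain ⟨p, x, hx⟩ := hinv j k v hjk
    refine mem_invsBefore.mpr ⟨?_, p, x, hx⟩
    by_contra! hak
    rcases lt_or_eq_of_le hak with hak | rfl
    · have hek : e < k := by
        by_contra! hke
        exact hA.alone k p x hak (lt_of_le_of_ne hke (hne j k v hjk)) hx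
      have := hS.lt_of_lt hA.resp hek (ht.mono hae.le) hi₀ hjk
      omega
    · have := hS.1.1 j i₀ a v L hjk hi₀
      omega
  -- The length condition on anchors serves to turn the inclusion into an equality.
  have heq : opsBefore S i₀ = H.invsBefore a :=
    Finset.eq_of_subset_of_card_le hsub (by rw [← hA.length, hS.1.length_eq hi₀])
  have hlater : ∀ k m L', H.IsResponse k m L' → e < k → ∃ i, S i = some (k, L') ∧ i₀ < i := by
    intro k m L' hk hek
    obtain ⟨i, hi⟩ := hS.2.2.2 k m L' hk (ht.mono (by have := hk.lt; omega))
    exact ⟨i, hi, hS.lt_of_lt hA.resp hek (ht.mono hae.le) hi₀ hi⟩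
  have hex : ∃ j, i₀ < j ∧ S j ≠ none := by
    obtain ⟨i, hi, hlt⟩ := hlater k m L' hk hek
    exact ⟨i, hlt, by simp [hi]⟩
  -- The next operation is the one at the first occupied position after that of `a`.
  obtain ⟨j, ⟨hj, hjn⟩, hmin⟩ : ∃ j, (i₀ < j ∧ S j ≠ none) ∧ ∀ j', i₀ < j' → S j' ≠ none → j ≤ j' :=
    ⟨Nat.find hex, Nat.find_spec hex, fun j' h1 h2 => Nat.find_min' hex ⟨h1, h2⟩⟩
  obtain ⟨⟨k', M⟩, hjk⟩ := Option.ne_none_iff_exists'.mp hjn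
  have hbefore : opsBefore S j = insert a (H.invsBefore a) := by
    ext q
    rw [Finset.mem_insert, ← heq, mem_opsBefore, mem_opsBefore]
    constructor
    · rintro ⟨i, hi, v, h⟩
      rcases lt_trichotomy i i₀ with hlt | rfl | hlt
      · exact .inr ⟨i, hlt, v, h⟩
      · simp only [hi₀, Option.some.injEq, Prod.mk.injEq] at h
        exact .inl h.1.symm
      · have := hmin i hlt (by simp [h])
        omega
    · rintro (rfl | ⟨i, hi, v, h⟩)
      · exact ⟨i₀, hj, L, hi₀⟩
      · exact ⟨i, by omega, v, h⟩
  have hM : (opsBefore S j).card = L.length + 1 := by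
    rw [hbefore, Finset.card_insert_of_notMem (by simp [mem_invsBefore]), hA.length]
  obtain ⟨p, x, hx⟩ := hinv j k' M hjk
  refine ⟨k', ?_, ⟨p, x, hx⟩, fun k₁ m₁ L₁ h₁ hk₁ => ?_⟩
  -- The operations invoked up to `a` already occupy positions before `j`.
  · by_contra! hle
    have hlt : k' < e := lt_of_le_of_ne hle (hne j k' M hjk)
    have hka : k' ≤ a := by
      by_contra! h
      exact hA.alone k' p x h hlt hx
    have hmem : k' ∈ opsBefore S j := by
      rw [hbefore, Finset.mem_insert, mem_invsBefore]
      rcases lt_or_eq_of_le hka with h | h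
      · exact .inr ⟨h, p, x, hx⟩
      · exact .inl h
    obtain ⟨i, hi, v, h⟩ := mem_opsBefore.mp hmem
    have := hS.1.1 i j k' v M h hjk
    omega
  · obtain ⟨i, hi, hlt⟩ := hlater k₁ m₁ L₁ h₁ hk₁
    have hji := hmin i hlt (by simp [hi])
    refine ⟨?_, ?_⟩
    -- If `k₁` had returned before `k'` was invoked, it would be linearized before `k'`, hence
    -- before the first occupied position.
    · by_contra! hle
      have hne' : m₁ ≠ k' := by
        rintro rfl
        obtain ⟨q, y, -, h', -⟩ := h₁
        simp [hx] at h'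
      have := hS.lt_of_lt h₁ (lt_of_le_of_ne hle hne')
        (ht.mono (by have := h₁.lt; omega)) hi hjk
      omega
    · rw [hS.1.length_eq hi, ← hM]
      constructor
      · intro hcard
        -- A later position has `k'` as an additional predecessor, hence a longer response.
        rcases lt_or_eq_of_le hji with h | rfl
        · have hss : insert k' (opsBefore S j) ⊆ opsBefore S i := by
            intro q hq
            rw [Finset.mem_insert, mem_opsBefore] at hq
            rw [mem_opsBefore]
            rcases hq with rfl | ⟨i', hi', v, hv⟩
            · exact ⟨j, h, M, hjk⟩
            · exact ⟨i', by omega, v, hv⟩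
          have hnot : k' ∉ opsBefore S j := by
            rw [mem_opsBefore]
            rintro ⟨i', hi', v, hv⟩
            have := hS.1.1 i' j k' v M hv hjk
            omega
          have := Finset.card_le_card hss
          rw [Finset.card_insert_of_notMem hnot] at this
          omega
        · simp only [hjk, Option.some.injEq, Prod.mk.injEq] at hi
          exact hi.1.symm
      · rintro rfl
        rw [hS.1.1 i j k₁ L₁ M hi hjk]

theorem exists_le_card_invsBefore {T : DataType} {H : History n T}
    (hinf : ∀ N, ∃ k, N ≤ k ∧ ∃ p x, H k = some (.inv p x)) (w : ℕ) :
    ∃ N, w ≤ (H.invsBefore N).card := by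
  induction w with
  | zero => exact ⟨0, Nat.zero_le _⟩
  | succ w ih =>
    obtain ⟨N, hN⟩ := ih
    obtain ⟨k, hk, hx⟩ := hinf N
    refine ⟨k + 1, ?_⟩
    have hsub : insert k (H.invsBefore N) ⊆ H.invsBefore (k + 1) := by
      intro j hj
      rcases Finset.mem_insert.mp hj with rfl | hj
      · exact mem_invsBefore.mpr ⟨by omega, hx⟩
      · obtain ⟨h1, h2⟩ := mem_invsBefore.mp hj
        exact mem_invsBefore.mpr ⟨by omega, h2⟩
    have := Finset.card_le_card hsub
    rw [Finset.card_insert_of_notMem fun h => by have := (mem_invsBefore.mp h).1; omega] at this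
    omega

theorem invsBefore_mono {T : DataType} {H : History n T} {a b : ℕ} (h : a ≤ b) :
    H.invsBefore a ⊆ H.invsBefore b := by
  intro k hk
  obtain ⟨h1, h2⟩ := mem_invsBefore.mp hk
  exact mem_invsBefore.mpr ⟨by omega, h2⟩

/-- A history in which infinitely many operations are performed, eventually one after the other,
has arbitrarily late anchors if it is `t`-linearizable for some `t`. -/
theorem IsTLinearization.exists_isAnchor {t K : ℕ} (hS : H.IsTLinearization t S)
    (hcomp : ∀ k p x, H k = some (.inv p x) → ∃ m L, H.IsResponse k m L)
    (hseq : ∀ k k' m L p x, K ≤ k → k < k' → H.IsResponse k m L → H k' = some (.inv p x) → m < k')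
    (hinf : ∀ N, ∃ k, N ≤ k ∧ ∃ p x, H k = some (.inv p x)) (w : ℕ) :
    ∃ a e L, w ≤ a ∧ H.IsAnchor a e L := by
  -- From `K'` on, the operations are sequential and their events lie in the suffix.
  obtain ⟨K', hKK', hK'⟩ : ∃ K', K ≤ K' ∧ H.InSuffix t K' := by
    have : ∀ t, ∃ K', K ≤ K' ∧ H.InSuffix t K' := by
      intro t
      induction t with
      | zero => exact ⟨K, le_rfl, inSuffix_zero _⟩
      | succ t ih =>
        obtain ⟨K', h1, h2⟩ := ih
        obtain ⟨k, hk, p, x, hx⟩ := hinf K'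
        refine ⟨k + 1, by omega, ?_⟩
        have := h2.mono hk
        simp only [InSuffix, Nat.count_succ] at this ⊢
        simp [hx, this]
    exact this t
  have hpos : ∀ k, ∃ i, (∃ p x, H k = some (.inv p x)) → ∃ L, S i = some (k, L) := by
    intro k
    by_cases h : ∃ p x, H k = some (.inv p x)
    · obtain ⟨p, x, hx⟩ := h
      obtain ⟨m, L, hr⟩ := hcomp k p x hx
      obtain ⟨i, L', hi⟩ := hS.2.1 k m L hr
      exact ⟨i, fun _ => ⟨L', hi⟩⟩
    · exact ⟨0, fun h' => absurd h' h⟩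
  choose pos hpos using hpos
  let A : Set ℕ := {a | (K' ≤ a ∧ w ≤ a) ∧ ∃ p x, H a = some (.inv p x)}
  have hA : A.Infinite := by
    refine Set.infinite_of_not_bddAbove ?_
    rintro ⟨B, hB⟩
    obtain ⟨k, hk, hx⟩ := hinf (B + K' + w + 1)
    have : k ≤ B := hB ⟨⟨by omega, by omega⟩, hx⟩
    omega
  have hinj : Set.InjOn pos A := by
    intro a ha a' ha' h
    obtain ⟨L, hL⟩ := hpos a ha.2
    obtain ⟨L', hL'⟩ := hpos a' ha'.2
    rw [h, hL'] at hL
    simp only [Option.some.injEq, Prod.mk.injEq] at hL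
    exact hL.1.symm
  -- Finitely many operations are invoked before `K'`, and positions are distinct, so some late `a`
  -- is linearized after all of them. The operations from `K'` on are linearized in real-time order,
  -- so exactly those invoked before `a` precede it.
  obtain ⟨-, ⟨a, ⟨⟨hKa, hwa⟩, p, x, hx⟩, rfl⟩, hgt⟩ :=
    (hA.image hinj).exists_gt ((H.invsBefore K').sup pos)
  obtain ⟨e, L, hr⟩ := hcomp a p x hx
  have hae := hr.lt
  obtain ⟨L', hi⟩ := hpos a ⟨p, x, hx⟩
  obtain ⟨i, hi'⟩ := hS.2.2.2 a e L hr (hK'.mono (by omega))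
  obtain rfl : pos a = i := hS.1.1 _ _ a L' L hi hi'
  refine ⟨a, e, L, hwa, hr, fun k q y hak hke hk => ?_, ?_⟩
  · have := hseq a k e L q y (by omega) hak hr hk
    omega
  · rw [hS.1.length_eq hi']
    congr 1
    ext k
    rw [mem_opsBefore, mem_invsBefore]
    constructor
    · rintro ⟨j, hj, v, hjk⟩
      obtain ⟨σ, -, hσ⟩ := hS.1.2
      obtain ⟨q, y, hk, -⟩ := (hσ j).2 k v hjk
      refine ⟨?_, q, y, hk⟩
      by_contra! hle
      rcases lt_or_eq_of_le hle with hlt | rfl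
      · have h1 := hseq a k e L q y (by omega) hlt hr hk
        have := hS.lt_of_lt hr h1 (hK'.mono (by omega)) hi' hjk
        omega
      · have := hS.1.1 _ _ a v L hjk hi'
        omega
    · rintro ⟨hka, q, y, hk⟩
      obtain ⟨M, hM⟩ := hpos k ⟨q, y, hk⟩
      refine ⟨pos k, ?_, M, hM⟩
      by_cases hkK : k < K'
      · exact lt_of_le_of_lt
          (Finset.le_sup (f := pos) (mem_invsBefore.mpr ⟨hkK, q, y, hk⟩)) hgt
      · obtain ⟨m, M', hm⟩ := hcomp k q y hk
        have hma := hseq k a m M' p x (by omega) hka hm hx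
        exact hS.lt_of_lt hm hma (hK'.mono (by have := hm.lt; omega)) hM hi'

end History

end EventualLin

namespace EventualLin

/-! ### Runs of programs -/

namespace SysHistory

variable {n : ℕ} {A B : Type} {T D : DataType} {ρ : SysHistory n A B T D}

theorem atTop_eq_some {k : ℕ} {e : Event n D} :
    ρ.atTop k = some e ↔ ρ k = some (.top e) := by
  unfold atTop
  split <;> simp_all

theorem atReg_eq_inv {a : A} {s k : ℕ} {p : Fin n} {x : Register.Inv} :
    ρ.atReg a s k = some (.inv p x) ↔ ρ k = some (.reg a (.inv p x)) := by
  unfold atReg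
  split
  · split_ifs with h <;> simp_all
  · split_ifs with h <;> simp_all
  · simp_all

theorem atReg_eq_res {a : A} {s k : ℕ} {p : Fin n} {v : Register.Res} :
    ρ.atReg a s k = some (.res p v) ↔ ρ k = some (.reg a (.res p v)) := by
  unfold atReg
  split
  · split_ifs with h <;> simp_all
  · split_ifs with h <;> simp_all
  · simp_all

theorem atObj_eq_inv {b : B} {s : T.State} {k : ℕ} {p : Fin n} {x : T.Inv} :
    ρ.atObj b s k = some (.inv p x) ↔ ρ k = some (.obj b (.inv p x)) := by
  unfold atObj
  split
  · split_ifs with h <;> simp_all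
  · split_ifs with h <;> simp_all
  · simp_all

theorem atObj_eq_res {b : B} {s : T.State} {k : ℕ} {p : Fin n} {v : T.Res} :
    ρ.atObj b s k = some (.res p v) ↔ ρ k = some (.obj b (.res p v)) := by
  unfold atObj
  split
  · split_ifs with h <;> simp_all
  · split_ifs with h <;> simp_all
  · simp_all

end SysHistory

namespace Program

variable {n : ℕ} {A B : Type} [Primcodable A] [Primcodable B] {T D : DataType}

/-- `c` is the sequence of the local states in an execution with the history `ρ`. -/
def IsRun (P : Program n A B T D) (ρ : SysHistory n A B T D)
    (c : ℕ → Fin n → P.Mem × Phase A B) : Prop :=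
  (∀ p, c 0 p = (P.memInit p, .idle)) ∧
    ∀ k, (ρ k = none → c (k + 1) = c k) ∧
      ∀ e, ρ k = some e →
        P.LocalStep e.proc (c k e.proc) e (c (k + 1) e.proc) ∧
        ∀ q, q ≠ e.proc → c (k + 1) q = c k q

variable {P : Program n A B T D} {ρ : SysHistory n A B T D} {c : ℕ → Fin n → P.Mem × Phase A B}

namespace IsRun

theorem step_or (hc : P.IsRun ρ c) (k : ℕ) (p : Fin n) :
    (c (k + 1) p = c k p ∧ ∀ e, ρ k = some e → e.proc ≠ p) ∨
    ∃ e, ρ k = some e ∧ e.proc = p ∧ P.LocalStep p (c k p) e (c (k + 1) p) := by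
  cases h : ρ k with
  | none => exact .inl ⟨by rw [(hc.2 k).1 h], by simp⟩
  | some e =>
    obtain ⟨h1, h2⟩ := (hc.2 k).2 e h
    by_cases hp : e.proc = p
    · subst hp
      exact .inr ⟨e, rfl, rfl, h1⟩
    · exact .inl ⟨h2 p (Ne.symm hp), by simpa using hp⟩

/-- What can happen to process `p` at instant `k`. -/
theorem step_cases (hc : P.IsRun ρ c) (k : ℕ) (p : Fin n) :
    (c (k + 1) p = c k p ∧ ∀ e, ρ k = some e → e.proc ≠ p) ∨
    (∃ m x, c k p = (m, .idle) ∧ ρ k = some (.top (.inv p x)) ∧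
      c (k + 1) p = (P.start p m x, .running)) ∨
    (∃ m a x, c k p = (m, .running) ∧ ρ k = some (.reg a (.inv p x)) ∧
      c (k + 1) p = (m, .waitReg a) ∧ P.next p m = .inl (.inl (a, x))) ∨
    (∃ m a v, c k p = (m, .waitReg a) ∧ ρ k = some (.reg a (.res p v)) ∧
      c (k + 1) p = (P.resume p m (.inl v), .running)) ∨
    (∃ m b x, c k p = (m, .running) ∧ ρ k = some (.obj b (.inv p x)) ∧
      c (k + 1) p = (m, .waitObj b) ∧ P.next p m = .inl (.inr (b, x))) ∨
    (∃ m b v, c k p = (m, .waitObj b) ∧ ρ k = some (.obj b (.res p v)) ∧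
      c (k + 1) p = (P.resume p m (.inr v), .running)) ∨
    (∃ m v, c k p = (m, .running) ∧ ρ k = some (.top (.res p v)) ∧
      c (k + 1) p = (m, .idle) ∧ P.next p m = .inr v) := by
  rcases hc.step_or k p with h | ⟨e, he, hp, h⟩
  · exact .inl h
  · right
    rw [he]
    generalize c k p = s at h
    generalize c (k + 1) p = s' at h
    cases h with
    | invoke m x => exact .inl ⟨m, x, rfl, rfl, rfl⟩
    | callReg m a x h => exact .inr (.inl ⟨m, a, x, rfl, rfl, rfl, h⟩)
    | replyReg m a v => exact .inr (.inr (.inl ⟨m, a, v, rfl, rfl, rfl⟩))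
    | callObj m b x h => exact .inr (.inr (.inr (.inl ⟨m, b, x, rfl, rfl, rfl, h⟩)))
    | replyObj m b v => exact .inr (.inr (.inr (.inr (.inl ⟨m, b, v, rfl, rfl, rfl⟩))))
    | respond m v h => exact .inr (.inr (.inr (.inr (.inr ⟨m, v, rfl, rfl, rfl, h⟩))))

theorem step_of_event (hc : P.IsRun ρ c) {k : ℕ} {e : SysEvent n A B T D} (h : ρ k = some e) :
    P.LocalStep e.proc (c k e.proc) e (c (k + 1) e.proc) :=
  ((hc.2 k).2 e h).1

theorem idle_of_inv (hc : P.IsRun ρ c) {k : ℕ} {p : Fin n} {x : D.Inv}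
    (h : ρ k = some (.top (.inv p x))) :
    ∃ m, c k p = (m, .idle) ∧ c (k + 1) p = (P.start p m x, .running) := by
  rcases hc.step_cases k p with h' | ⟨m, y, h1, h2, h3⟩ | ⟨m, a, y, -, h2, -⟩ |
    ⟨m, a, v, -, h2, -⟩ | ⟨m, b, y, -, h2, -⟩ | ⟨m, b, v, -, h2, -⟩ | ⟨m, v, -, h2, -⟩
  · exact absurd rfl (h'.2 _ h)
  · obtain rfl : x = y := by simpa [h] using h2
    exact ⟨m, h1, h3⟩
  all_goals simp [h] at h2

theorem running_of_res (hc : P.IsRun ρ c) {k : ℕ} {p : Fin n} {v : D.Res}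
    (h : ρ k = some (.top (.res p v))) :
    ∃ m, c k p = (m, .running) ∧ c (k + 1) p = (m, .idle) ∧ P.next p m = .inr v := by
  rcases hc.step_cases k p with h' | ⟨m, y, h1, h2, h3⟩ | ⟨m, a, y, -, h2, -⟩ |
    ⟨m, a, v, -, h2, -⟩ | ⟨m, b, y, -, h2, -⟩ | ⟨m, b, v, -, h2, -⟩ | ⟨m, w, h1, h2, h3, h4⟩
  · exact absurd rfl (h'.2 _ h)
  all_goals try simp [h] at h2
  subst h2
  exact ⟨m, h1, h3, h4⟩

/-- A process that is not idle has a pending operation. -/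
theorem exists_pending (hc : P.IsRun ρ c) {k : ℕ} {p : Fin n} (h : (c k p).2 ≠ .idle) :
    ∃ j x, j < k ∧ ρ.atTop j = some (.inv p x) ∧
      ∀ i, j < i → i < k → ∀ e, ρ.atTop i = some e → e.proc ≠ p := by
  induction k with
  | zero => simp [hc.1] at h
  | succ k ih =>
    have extend : (c k p).2 ≠ .idle → (∀ e, ρ k = some (.top e) → e.proc ≠ p) →
        ∃ j x, j < k + 1 ∧ ρ.atTop j = some (.inv p x) ∧
          ∀ i, j < i → i < k + 1 → ∀ e, ρ.atTop i = some e → e.proc ≠ p := by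
      intro h1 h2
      obtain ⟨j, x, hj, hx, hi⟩ := ih h1
      refine ⟨j, x, by omega, hx, fun i hji hik e he => ?_⟩
      rcases Nat.lt_succ_iff_lt_or_eq.mp hik with hik | rfl
      · exact hi i hji hik e he
      · exact h2 e (SysHistory.atTop_eq_some.mp he)
    rcases hc.step_cases k p with h' | ⟨m, y, h1, h2, h3⟩ | ⟨m, a, y, h1, h2, -⟩ |
      ⟨m, a, v, h1, h2, -⟩ | ⟨m, b, y, h1, h2, -⟩ | ⟨m, b, v, h1, h2, -⟩ | ⟨m, w, -, -, h3, -⟩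
    · exact extend (by rwa [h'.1] at h) fun e he => h'.2 _ he
    · exact ⟨k, y, by omega, SysHistory.atTop_eq_some.mpr h2, fun i _ _ => by omega⟩
    · exact extend (by simp [h1]) (by simp [h2])
    · exact extend (by simp [h1]) (by simp [h2])
    · exact extend (by simp [h1]) (by simp [h2])
    · exact extend (by simp [h1]) (by simp [h2])
    · simp [h3] at h

/-- A process that is idle has completed its operations. -/
theorem exists_response_of_idle (hc : P.IsRun ρ c) {k : ℕ} {p : Fin n} (h : (c k p).2 = .idle)
    {j : ℕ} {x : D.Inv} (hj : j < k) (hx : ρ.atTop j = some (.inv p x)) :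
    ∃ m v, m < k ∧ ρ.atTop.IsResponse j m v := by
  induction k using Nat.strong_induction_on with
  | _ k ih =>
    obtain ⟨k, rfl⟩ : ∃ k', k = k' + 1 := ⟨k - 1, by omega⟩
    have hx' := SysHistory.atTop_eq_some.mp hx
    rcases hc.step_cases k p with h' | ⟨m, y, h1, h2, h3⟩ | ⟨m, a, y, h1, h2, h3, -⟩ |
      ⟨m, a, v, h1, h2, h3⟩ | ⟨m, b, y, h1, h2, h3, -⟩ | ⟨m, b, v, h1, h2, h3⟩ |
      ⟨m, w, h1, h2, h3, -⟩
    · rcases Nat.lt_succ_iff_lt_or_eq.mp hj with hj | rfl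
      · obtain ⟨m, v, hm, hr⟩ := ih k (by omega) (by rwa [h'.1] at h) hj
        exact ⟨m, v, by omega, hr⟩
      · exact absurd rfl (h'.2 _ hx')
    · simp [h3] at h
    · simp [h3] at h
    · simp [h3] at h
    · simp [h3] at h
    · simp [h3] at h
    · have hjk : j ≠ k := by
        rintro rfl
        simp [hx'] at h2
      obtain ⟨i, y, hi, hy, hbet⟩ := hc.exists_pending (k := k) (p := p) (by simp [h1])
      have hr : ρ.atTop.IsResponse i k w :=
        ⟨p, y, hy, SysHistory.atTop_eq_some.mpr h2, hi, hbet⟩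
      -- This response closes the pending operation `i`. An earlier operation was complete when `i`
      -- was invoked, because the process was idle then.
      rcases lt_trichotomy j i with hji | rfl | hji
      · obtain ⟨m', hm', -⟩ := hc.idle_of_inv (SysHistory.atTop_eq_some.mp hy)
        obtain ⟨m, v, hm, hr⟩ := ih i (by omega) (by rw [hm']) hji
        exact ⟨m, v, by omega, hr⟩
      · exact ⟨k, w, by omega, hr⟩
      · exact absurd rfl (hbet j hji (by omega) _ hx)

/-- A response finds its process running, so an operation is pending; an invocation finds it idle,
so all its earlier operations are complete. -/
theorem wellFormed (hc : P.IsRun ρ c) : ρ.atTop.WellFormed := by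
  refine ⟨fun m p v hm => ?_, fun k k' p x x' hlt hk hk' => ?_⟩
  · obtain ⟨w, hw, -⟩ := hc.running_of_res (SysHistory.atTop_eq_some.mp hm)
    obtain ⟨j, x, hj, hx, hbet⟩ := hc.exists_pending (k := m) (p := p) (by simp [hw])
    exact ⟨j, p, x, hx, hm, hj, hbet⟩
  · obtain ⟨w, hw, -⟩ := hc.idle_of_inv (SysHistory.atTop_eq_some.mp hk')
    exact hc.exists_response_of_idle (by simp [hw]) hlt hk

/-- If a rank decreases with each step of an operation, then a process that keeps taking steps
completes its operations. -/
theorem exists_response_of_rank (hc : P.IsRun ρ c) {p : Fin n} (rank : P.Mem × Phase A B → ℕ)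
    (hrank : ∀ s e s', P.LocalStep p s e s' → s.2 ≠ .idle → s'.2 ≠ .idle → rank s' < rank s)
    {k : ℕ} {x : D.Inv} (hk : ρ.atTop k = some (.inv p x))
    (hinf : ∀ N, ∃ j, N ≤ j ∧ ∃ e, ρ j = some e ∧ e.proc = p) :
    ∃ m v, ρ.atTop.IsResponse k m v := by
  classical
  -- Induction on the rank at an instant `j` inside the operation: the next event of `p` is the
  -- response or lowers the rank.
  suffices key : ∀ r j, rank (c j p) = r → k < j → (c j p).2 ≠ .idle →
      (∀ i, k < i → i < j → ∀ e, ρ.atTop i = some e → e.proc ≠ p) →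
      ∃ m v, ρ.atTop.IsResponse k m v by
    obtain ⟨m, -, h⟩ := hc.idle_of_inv (SysHistory.atTop_eq_some.mp hk)
    exact key _ (k + 1) rfl (by omega) (by simp [h]) fun i _ _ => by omega
  intro r
  induction r using Nat.strong_induction_on with
  | _ r ih =>
    intro j hr hkj hidle hbet
    obtain ⟨j', ⟨hj', e, he, hp⟩, hmin⟩ : ∃ j', (j ≤ j' ∧ ∃ e, ρ j' = some e ∧ e.proc = p) ∧
        ∀ i, j ≤ i → (∃ e, ρ i = some e ∧ e.proc = p) → j' ≤ i :=
      ⟨Nat.find (hinf j), Nat.find_spec (hinf j), fun i h1 h2 => Nat.find_min' _ ⟨h1, h2⟩⟩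
    have hsame : ∀ i, j ≤ i → i ≤ j' → c i p = c j p := by
      intro i hji
      induction i, hji using Nat.le_induction with
      | base => exact fun _ => rfl
      | succ i hji ih =>
        intro hij
        rcases hc.step_or i p with h | ⟨e', he', hp', -⟩
        · rw [h.1, ih (by omega)]
        · have := hmin i hji ⟨e', he', hp'⟩
          omega
    have hbet' : ∀ i, k < i → i < j' → ∀ e, ρ.atTop i = some e → e.proc ≠ p := by
      intro i hki hij e' he'
      by_cases hi : i < j
      · exact hbet i hki hi e' he'
      · intro hp'
        have := hmin i (by omega) ⟨_, SysHistory.atTop_eq_some.mp he', hp'⟩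
        omega
    have hj := hsame j' hj' le_rfl
    rw [← hj] at hr hidle
    subst hp
    have hstep := hc.step_of_event he
    by_cases hend : (c (j' + 1) e.proc).2 = .idle
    · rcases hc.step_cases j' e.proc with h' | ⟨m, y, h1, h2, h3⟩ | ⟨m, a, y, h1, h2, h3, -⟩ |
        ⟨m, a, v, h1, h2, h3⟩ | ⟨m, b, y, h1, h2, h3, -⟩ | ⟨m, b, v, h1, h2, h3⟩ |
        ⟨m, w, h1, h2, h3, -⟩
      · exact absurd rfl (h'.2 _ he)
      · simp [h1] at hidle
      · simp [h3] at hend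
      · simp [h3] at hend
      · simp [h3] at hend
      · simp [h3] at hend
      · exact ⟨j', w, e.proc, x, hk, SysHistory.atTop_eq_some.mpr h2, by omega, hbet'⟩
    · refine ih _ (hr ▸ hrank _ _ _ hstep hidle hend) (j' + 1) rfl (by omega) hend ?_
      intro i hki hij e' he'
      rcases Nat.lt_succ_iff_lt_or_eq.mp hij with hij | rfl
      · exact hbet' i hki hij e' he'
      · rw [SysHistory.atTop_eq_some] at he'
        obtain rfl : e = .top e' := by simpa [he] using he'
        exfalso
        generalize c i (SysEvent.top e').proc = s at hstep hidle
        generalize c (i + 1) (SysEvent.top e').proc = s' at hstep hend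
        generalize (SysEvent.top e' : SysEvent n A B T D).proc = q at hstep
        cases hstep with
        | invoke => exact hidle rfl
        | respond => exact hend rfl

end IsRun

end Program

end EventualLin

namespace EventualLin

/-! ### Fetch-and-cons for one process -/

/-- A single process keeps the list in its local memory, together with its last response. -/
def localFetchAndCons (V : Type) [Primcodable V] : Program 1 ℕ ℕ TestAndSet (FetchAndCons V) where
  Mem := List V × List V
  regInit _ := 0
  objInit _ := false
  objInit_mem _ := rfl
  memInit _ := ([], [])
  start _ m x := (x :: m.1, m.1)
  next _ m := .inr m.2
  resume _ m _ := m
  computable_regInit := Computable.const 0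
  computable_start _ := (Computable.pair (Computable.list_cons.comp Computable.snd
    (Computable.fst.comp Computable.fst)) (Computable.fst.comp Computable.fst))
  computable_next _ := (Primrec.sumInr.comp Primrec.snd).to_comp
  computable_resume _ := Computable.fst

/-- Operations take effect at their responses. As `start` conses the new value at once, the abstract
list is the first memory component while the process is idle, but the second one (the stored
response) while it is running. -/
theorem localFetchAndCons_linearizable (V : Type) [Primcodable V]
    {ρ : SysHistory 1 ℕ ℕ TestAndSet (FetchAndCons V)}
    {c : ℕ → Fin 1 → (List V × List V) × Phase ℕ ℕ} (hc : (localFetchAndCons V).IsRun ρ c) :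
    ρ.atTop.Linearizable := by
  have state : ∀ k, (∃ m, c k 0 = (m, .idle)) ∨ ∃ j x L, ρ.atTop j = some (.inv 0 x) ∧ j < k ∧
      (∀ i, j < i → i < k → ∀ e, ρ.atTop i ≠ some e) ∧ c k 0 = ((x :: L, L), .running) := by
    intro k
    induction k with
    | zero => exact .inl ⟨_, hc.1 0⟩
    | succ k ih =>
      rcases hc.step_cases k 0 with h' | ⟨m, y, h1, h2, h3⟩ | ⟨m, a, y, -, -, -, h4⟩ |
        ⟨m, a, v, h1, h2, h3⟩ | ⟨m, b, y, -, -, -, h4⟩ | ⟨m, b, v, h1, h2, h3⟩ |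
        ⟨m, w, -, -, h3, -⟩
      · rw [h'.1]
        refine ih.imp id ?_
        rintro ⟨j, x, L, h1, h2, h3, h4⟩
        refine ⟨j, x, L, h1, by omega, fun i hj hi e he => ?_, h4⟩
        rcases Nat.lt_succ_iff_lt_or_eq.mp hi with hi | rfl
        · exact h3 i hj hi e he
        · exact h'.2 _ (SysHistory.atTop_eq_some.mp he) (Subsingleton.elim _ _)
      · exact .inr ⟨k, y, m.1, SysHistory.atTop_eq_some.mpr h2, by omega,
          fun i _ _ => by omega, h3⟩
      · cases h4
      · rcases ih with ⟨m, h⟩ | ⟨j, x, L, -, -, -, h⟩ <;> cases h1.symm.trans h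
      · cases h4
      · rcases ih with ⟨m, h⟩ | ⟨j, x, L, -, -, -, h⟩ <;> cases h1.symm.trans h
      · exact .inl ⟨m, h3⟩
  let list : (List V × List V) × Phase ℕ ℕ → List V := fun s =>
    match s with
    | (m, .idle) => m.1
    | (m, _) => m.2
  refine History.linearizable_of_response hc.wellFormed (fun k => list (c k 0)) ?_ ?_ ?_
  · simp [hc.1, list, localFetchAndCons]
  · intro k hk
    rcases hc.step_cases k 0 with h' | ⟨m, y, h1, h2, h3⟩ | ⟨m, a, y, -, -, -, h4⟩ |
      ⟨m, a, v, h1, -, -⟩ | ⟨m, b, y, -, -, -, h4⟩ | ⟨m, b, v, h1, -, -⟩ | ⟨m, w, -, h2, -, -⟩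
    · simp only [h'.1]
    · simp [h1, h3, list, localFetchAndCons]
    · cases h4
    · rcases state k with ⟨m, h⟩ | ⟨j, x, L, -, -, -, h⟩ <;> cases h1.symm.trans h
    · cases h4
    · rcases state k with ⟨m, h⟩ | ⟨j, x, L, -, -, -, h⟩ <;> cases h1.symm.trans h
    · exact absurd (SysHistory.atTop_eq_some.mpr h2) (hk 0 w)
  · intro k m v p x hr hx
    obtain rfl : p = 0 := Subsingleton.elim _ _
    obtain ⟨q, y, hy, hm, hkm, hbet⟩ := id hr
    obtain rfl : q = 0 := Subsingleton.elim _ _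
    obtain ⟨w, h1, h2, h3⟩ := hc.running_of_res (SysHistory.atTop_eq_some.mp hm)
    rcases state m with ⟨_, h⟩ | ⟨j, z, L, hj, hjm, hbet', h⟩
    · cases h1.symm.trans h
    · obtain rfl : k = j := by
        rcases lt_trichotomy k j with h | h | h
        · exact absurd rfl (hbet j h hjm _ hj)
        · exact h
        · exact absurd hx (hbet' k h hkm _)
      obtain rfl : x = z := by simpa [hx] using hj
      obtain rfl : w = (x :: L, L) := congrArg Prod.fst (h1.symm.trans h)
      obtain rfl : L = v := by simpa [localFetchAndCons] using h3
      simp [h1, h2, list]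

theorem localFetchAndCons_eventuallyImplements (V : Type) [Primcodable V] :
    (localFetchAndCons V).EventuallyImplements := by
  refine ⟨?_, ?_⟩
  · rintro ρ ⟨⟨c, hc⟩, -⟩ p k x hk hinf
    refine Program.IsRun.exists_response_of_rank (P := localFetchAndCons V) hc
      -- Waiting phases never occur, but `LocalStep` allows replies in them, so they are ranked
      -- above `running`.
      (fun s => match s.2 with | .running => 0 | _ => 1) ?_ hk hinf
    intro s e s' h hs hs'
    cases h with
    | invoke m x => exact absurd rfl hs
    | callReg m a x h => cases h
    | replyReg m a v => exact Nat.zero_lt_one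
    | callObj m b x h => cases h
    | replyObj m b v => exact Nat.zero_lt_one
    | respond m v h => exact absurd rfl hs'
  · rintro ρ ⟨⟨c, hc⟩, -⟩
    exact (localFetchAndCons_linearizable V hc).eventuallyLinearizable

/-! ### Test-and-set from a register -/

namespace History

variable {n : ℕ} {R : History n (Register.initialized 0)}

/-- Before instant `k`, a write to the register or a read with a value other than `0` has been
completed. -/
def Seen (R : History n (Register.initialized 0)) (k : ℕ) : Prop :=
  ∃ r m p x v, R.IsResponse r m v ∧ m < k ∧ R r = some (.inv p x) ∧ (x ≠ none ∨ v ≠ some 0)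

theorem Seen.mono {k k' : ℕ} (h : R.Seen k) (hk : k ≤ k') : R.Seen k' := by
  obtain ⟨r, m, p, x, v, h1, h2, h3⟩ := h
  exact ⟨r, m, p, x, v, h1, by omega, h3⟩

/-- As `0` is never written, a nonzero register stays nonzero. The operation that witnesses `Seen`
leaves it nonzero and is linearized before the read. -/
theorem Seen.read_ne_zero {r m : ℕ} {p : Fin n} {v : Register.Res} (h : R.Seen r)
    (hR : R.Linearizable) (hw : ∀ k p, R k ≠ some (.inv p (some 0))) (hr : R.IsResponse r m v)
    (hx : R r = some (.inv p none)) : v ≠ some 0 := by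
  obtain ⟨r₀, m₀, p₀, x₀, v₀, hr₀, hm₀, hx₀, hne⟩ := h
  obtain ⟨-, S, hS⟩ := hR
  obtain ⟨i, hi⟩ := hS.2.2.2 r m v hr (inSuffix_zero _)
  obtain ⟨i₀, hi₀⟩ := hS.2.2.2 r₀ m₀ v₀ hr₀ (inSuffix_zero _)
  have hlt := hS.lt_of_lt hr₀ hm₀ (inSuffix_zero _) hi₀ hi
  obtain ⟨σ, -, hσ⟩ := hS.1.2
  have hstep : ∀ j, σ j ≠ (0 : ℕ) → σ (j + 1) ≠ (0 : ℕ) := by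
    intro j hj
    cases h : S j with
    | none => rwa [(hσ j).1 h]
    | some kv =>
      obtain ⟨q, y, hy, hδ⟩ := (hσ j).2 kv.1 kv.2 h
      rcases y with _ | y
      · have hδ : σ (j + 1) = σ j := (congrArg Prod.snd hδ).symm
        rwa [hδ]
      · have hδ : σ (j + 1) = y := (congrArg Prod.snd hδ).symm
        rw [hδ]
        rintro rfl
        exact hw _ _ hy
  have hmono : ∀ j, i₀ + 1 ≤ j → σ (i₀ + 1) ≠ (0 : ℕ) → σ j ≠ (0 : ℕ) := by
    intro j hj h0
    induction j, hj using Nat.le_induction with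
    | base => exact h0
    | succ j _ ih => exact hstep j ih
  have h0 : σ (i₀ + 1) ≠ (0 : ℕ) := by
    obtain ⟨q, y, hy, hδ⟩ := (hσ i₀).2 r₀ v₀ hi₀
    obtain ⟨rfl, rfl⟩ : q = p₀ ∧ y = x₀ := by simpa [hy] using hx₀
    rcases y with _ | y
    · have h₁ : v₀ = some (σ i₀) := (congrArg Prod.fst hδ).symm
      have h₂ : σ (i₀ + 1) = σ i₀ := (congrArg Prod.snd hδ).symm
      intro h
      simp [h₁, ← h₂, h] at hne
    · have h₂ : σ (i₀ + 1) = y := (congrArg Prod.snd hδ).symm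
      rw [h₂]
      rintro rfl
      exact hw _ _ hx₀
  obtain ⟨q, y, hy, hδ⟩ := (hσ i).2 r v hi
  obtain ⟨rfl, rfl⟩ : q = p ∧ y = none := by simpa [hy] using hx
  have hδ₁ : v = some (σ i) := (congrArg Prod.fst hδ).symm
  rw [hδ₁]
  intro h
  exact hmono i hlt h0 (Option.some.inj h)

/-- The register starts with `0`, so a nonzero read has a write linearized before it, and real-time
order forbids that this write be invoked after the read has returned. -/
theorem Seen.exists_write {k : ℕ} (h : R.Seen k) (hR : R.Linearizable) :
    ∃ w p x, w < k ∧ R w = some (.inv p (some x)) := by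
  obtain ⟨r₀, m₀, p₀, x₀, v₀, hr₀, hm₀, hx₀, hne⟩ := h
  rcases x₀ with _ | x₀
  swap
  · exact ⟨r₀, p₀, x₀, by have := hr₀.lt; omega, hx₀⟩
  obtain ⟨-, S, hS⟩ := hR
  obtain ⟨i₀, hi₀⟩ := hS.2.2.2 r₀ m₀ v₀ hr₀ (inSuffix_zero _)
  obtain ⟨σ, h0, hσ⟩ := hS.1.2
  by_contra! hno
  have hzero : ∀ j ≤ i₀, σ j = (0 : ℕ) := by
    intro j
    induction j with
    | zero => exact fun _ => h0
    | succ j ih =>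
      intro hj
      cases h : S j with
      | none => rw [(hσ j).1 h, ih (by omega)]
      | some kv =>
        obtain ⟨q, y, hy, hδ⟩ := (hσ j).2 kv.1 kv.2 h
        rcases y with _ | y
        · have hδ : σ (j + 1) = σ j := (congrArg Prod.snd hδ).symm
          rw [hδ, ih (by omega)]
        · by_cases hlt : kv.1 < k
          · exact absurd hy (hno _ _ _ hlt)
          · have := hS.lt_of_lt hr₀ (show m₀ < kv.1 by omega) (inSuffix_zero _) hi₀ h
            omega
  obtain ⟨q, y, hy, hδ⟩ := (hσ i₀).2 r₀ v₀ hi₀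
  obtain ⟨rfl, rfl⟩ : q = p₀ ∧ y = none := by simpa [hy] using hx₀
  have hδ₁ : v₀ = some (σ i₀) := (congrArg Prod.fst hδ).symm
  rw [hδ₁, hzero i₀ le_rfl] at hne
  simp at hne

end History

/-- Test-and-set from a register: an operation reads the register; if the value is not `0`, it
loses, otherwise it writes `1` and wins. The memory is the program counter: `0` before the read,
`1` before the write, `2` before winning and `3` before losing. -/
def registerTestAndSet (n : ℕ) : Program n (Fin 1) (Fin 0) TestAndSet TestAndSet where
  Mem := ℕ
  regInit _ := 0
  objInit _ := false
  objInit_mem _ := rfl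
  memInit _ := 0
  start _ _ _ := 0
  next _ m := if m = 0 then .inl (.inl (0, none)) else
    if m = 1 then .inl (.inl (0, some 1)) else .inr (decide (m = 2))
  resume _ m r := if m = 0 then (if r = .inl (some 0) then 1 else 3) else 2
  computable_regInit := Computable.const 0
  computable_start _ := Computable.const 0
  computable_next _ := by
    refine Primrec.to_comp (Primrec.ite (Primrec.eq.comp Primrec.id (Primrec.const 0))
      (Primrec.const _) (Primrec.ite (Primrec.eq.comp Primrec.id (Primrec.const 1))
      (Primrec.const _) (Primrec.sumInr.comp ?_)))
    exact Primrec.eq.decide.comp Primrec.id (Primrec.const 2)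
  computable_resume _ := by
    refine Primrec.to_comp (Primrec.ite (Primrec.eq.comp Primrec.fst (Primrec.const 0))
      (Primrec.ite (Primrec.eq.comp Primrec.snd (Primrec.const _)) (Primrec.const 1)
        (Primrec.const 3)) (Primrec.const 2))

end EventualLin

namespace EventualLin

/-! ### Invariants and correctness of the register-based test-and-set. -/

namespace Program.IsRun

variable {n : ℕ} {A B : Type} [Primcodable A] [Primcodable B] {T D : DataType}
  {P : Program n A B T D} {ρ : SysHistory n A B T D} {c : ℕ → Fin n → P.Mem × Phase A B}

theorem running_of_reg_inv (hc : P.IsRun ρ c) {k : ℕ} {a : A} {p : Fin n} {x : Register.Inv}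
    (h : ρ k = some (.reg a (.inv p x))) :
    ∃ m, c k p = (m, .running) ∧ P.next p m = .inl (.inl (a, x)) := by
  rcases hc.step_cases k p with h' | ⟨m, y, -, h2, -⟩ | ⟨m, b, y, h1, h2, -, h4⟩ |
    ⟨m, b, v, -, h2, -⟩ | ⟨m, b, y, -, h2, -⟩ | ⟨m, b, v, -, h2, -⟩ | ⟨m, w, -, h2, -⟩
  · exact absurd rfl (h'.2 _ h)
  · simp [h] at h2
  · simp only [h, Option.some.injEq, SysEvent.reg.injEq, Event.inv.injEq, true_and] at h2
    obtain ⟨rfl, rfl⟩ := h2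
    exact ⟨m, h1, h4⟩
  all_goals simp [h] at h2

end Program.IsRun

namespace RegisterTestAndSet

variable {n : ℕ}

/-- Process `p` has not completed any operation before instant `k`. -/
def NoRes (ρ : SysHistory n (Fin 1) (Fin 0) TestAndSet TestAndSet) (p : Fin n) (k : ℕ) : Prop :=
  ∀ j < k, ∀ v, ρ j ≠ some (.top (.res p v))

/-- Process `p` has neither completed an operation nor written to the register. -/
def Fresh (ρ : SysHistory n (Fin 1) (Fin 0) TestAndSet TestAndSet) (p : Fin n) (k : ℕ) : Prop :=
  NoRes ρ p k ∧ ∀ j < k, ∀ a x, ρ j ≠ some (.reg a (.inv p (some x)))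

/-- The last event of process `p` before instant `k` is the invocation `x` of the register. -/
def Pending (ρ : SysHistory n (Fin 1) (Fin 0) TestAndSet TestAndSet) (p : Fin n) (k r : ℕ)
    (x : Register.Inv) : Prop :=
  r < k ∧ ρ r = some (.reg 0 (.inv p x)) ∧ ∀ i, r < i → i < k → ∀ e, ρ i = some e → e.proc ≠ p

/-- What is known about the history if process `p` is in a given local state at instant `k`. -/
inductive Known (ρ : SysHistory n (Fin 1) (Fin 0) TestAndSet TestAndSet) (p : Fin n) (k : ℕ) :
    ℕ × Phase (Fin 1) (Fin 0) → Prop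
  | idle (m : ℕ) (h : Fresh ρ p k ∨ ¬ NoRes ρ p k ∧ (ρ.atReg 0 0).Seen k) :
      Known ρ p k (m, .idle)
  | start (h : Fresh ρ p k ∨ ¬ NoRes ρ p k ∧ (ρ.atReg 0 0).Seen k) : Known ρ p k (0, .running)
  -- `Seen` is required at the invocation `r` of the read, not just at `k`: only then is the read
  -- bound to return a nonzero value.
  | read (r : ℕ) (hr : Pending ρ p k r none)
      (h : Fresh ρ p k ∨ ¬ NoRes ρ p k ∧ (ρ.atReg 0 0).Seen r) : Known ρ p k (0, .waitReg 0)
  | unset (h : Fresh ρ p k) : Known ρ p k (1, .running)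
  | write (r : ℕ) (hr : Pending ρ p k r (some 1)) (h : NoRes ρ p k) : Known ρ p k (1, .waitReg 0)
  | win (h : NoRes ρ p k) (hs : (ρ.atReg 0 0).Seen k) : Known ρ p k (2, .running)
  -- Either case provides another operation to blame for the loss: that of a different process which
  -- wrote, or an earlier one of `p`.
  | lose (h : Fresh ρ p k ∨ ¬ NoRes ρ p k) (hs : (ρ.atReg 0 0).Seen k) : Known ρ p k (3, .running)

variable {ρ : SysHistory n (Fin 1) (Fin 0) TestAndSet TestAndSet} {p : Fin n} {k : ℕ}

theorem NoRes.succ (h : NoRes ρ p k) (hk : ∀ v, ρ k ≠ some (.top (.res p v))) :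
    NoRes ρ p (k + 1) := by
  intro j hj
  rcases Nat.lt_succ_iff_lt_or_eq.mp hj with hj | rfl
  · exact h j hj
  · exact hk

theorem NoRes.of_succ (h : NoRes ρ p (k + 1)) : NoRes ρ p k := fun j hj => h j (by omega)

theorem Fresh.succ (h : Fresh ρ p k) (hk : ∀ v, ρ k ≠ some (.top (.res p v)))
    (hw : ∀ a x, ρ k ≠ some (.reg a (.inv p (some x)))) : Fresh ρ p (k + 1) := by
  refine ⟨h.1.succ hk, fun j hj => ?_⟩
  rcases Nat.lt_succ_iff_lt_or_eq.mp hj with hj | rfl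
  · exact h.2 j hj
  · exact hw

theorem Pending.succ {r : ℕ} {x : Register.Inv} (h : Pending ρ p k r x)
    (hk : ∀ e, ρ k = some e → e.proc ≠ p) : Pending ρ p (k + 1) r x := by
  refine ⟨by have := h.1; omega, h.2.1, fun i hri hik => ?_⟩
  rcases Nat.lt_succ_iff_lt_or_eq.mp hik with hik | rfl
  · exact h.2.2 i hri hik
  · exact hk

theorem Pending.isResponse {r : ℕ} {x : Register.Inv} (h : Pending ρ p k r x) {a : Fin 1}
    {v : Register.Res} (hk : ρ k = some (.reg a (.res p v))) :
    (ρ.atReg 0 0).IsResponse r k v := by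
  obtain rfl : a = 0 := Subsingleton.elim _ _
  refine ⟨p, x, SysHistory.atReg_eq_inv.mpr h.2.1, SysHistory.atReg_eq_res.mpr hk, h.1,
    fun i hri hik e he => ?_⟩
  cases e with
  | inv q y => exact h.2.2 i hri hik _ (SysHistory.atReg_eq_inv.mp he)
  | res q y => exact h.2.2 i hri hik _ (SysHistory.atReg_eq_res.mp he)

theorem resume_zero_of_eq (p : Fin n) :
    (registerTestAndSet n).resume p (0 : ℕ) (.inl (some 0)) = (1 : ℕ) := rfl

theorem resume_zero_of_ne (p : Fin n) {v : Register.Res} (hv : v ≠ some 0) :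
    (registerTestAndSet n).resume p (0 : ℕ) (.inl v) = (3 : ℕ) := by
  simp [registerTestAndSet, hv]

/-- The point is that a process with a completed operation has `Seen` when it reads again. By
`read_ne_zero` the value is then nonzero, so the process never returns to the branch that writes and
wins. -/
theorem known {c : ℕ → Fin n → ℕ × Phase (Fin 1) (Fin 0)}
    (hc : (registerTestAndSet n).IsRun ρ c) (hR : (ρ.atReg 0 0).Linearizable) (k : ℕ)
    (p : Fin n) : Known ρ p k (c k p) := by
  have hw : ∀ k p, ρ.atReg 0 0 k ≠ some (.inv p (some 0)) := by
    intro k p h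
    obtain ⟨m, -, hm⟩ := hc.running_of_reg_inv (SysHistory.atReg_eq_inv.mp h)
    simp only [registerTestAndSet] at hm
    split_ifs at hm <;> simp at hm
  induction k with
  | zero =>
    rw [hc.1]
    exact .idle _ (.inl ⟨fun j hj => by omega, fun j hj => by omega⟩)
  | succ k ih =>
    rcases hc.step_cases k p with h' | ⟨m, y, h1, h2, h3⟩ | ⟨m, a, y, h1, h2, h3, h4⟩ |
      ⟨m, a, v, h1, h2, h3⟩ | ⟨m, b, -⟩ | ⟨m, b, -⟩ | ⟨m, w, h1, h2, h3, h4⟩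
    · rw [h'.1]
      have hres : ∀ v, ρ k ≠ some (.top (.res p v)) := fun v h => h'.2 _ h rfl
      have hwr : ∀ a x, ρ k ≠ some (.reg a (.inv p (some x))) := fun a x h => h'.2 _ h rfl
      have hF : Fresh ρ p k → Fresh ρ p (k + 1) := fun h => h.succ hres hwr
      have hN : ¬ NoRes ρ p k → ¬ NoRes ρ p (k + 1) := fun h h' => h h'.of_succ
      have hS : (ρ.atReg 0 0).Seen k → (ρ.atReg 0 0).Seen (k + 1) := fun h => h.mono (by omega)
      generalize c k p = s at ih
      cases ih with
      | idle m h => exact .idle m (h.imp hF (And.imp hN hS))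
      | start h => exact .start (h.imp hF (And.imp hN hS))
      | read r hr h => exact .read r (hr.succ h'.2) (h.imp hF (And.imp_left hN))
      | unset h => exact .unset (hF h)
      | write r hr h => exact .write r (hr.succ h'.2) (h.succ hres)
      | win h hs => exact .win (h.succ hres) (hS hs)
      | lose h hs => exact .lose (h.imp hF hN) (hS hs)
    · rw [h1] at ih
      rw [h3]
      cases ih with
      | idle m h =>
        exact .start (h.imp (fun h => h.succ (by simp [h2]) (by simp [h2]))
          (And.imp (fun h h' => h h'.of_succ) fun h => h.mono (by omega)))
    · rw [h1] at ih
      rw [h3]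
      obtain rfl : a = 0 := Subsingleton.elim _ _
      cases ih with
      | start h =>
        cases h4
        exact .read k ⟨by omega, h2, fun i _ _ => by omega⟩
          (h.imp (fun h => h.succ (by simp [h2]) (by simp [h2]))
            (And.imp_left fun h h' => h h'.of_succ))
      | unset h =>
        cases h4
        exact .write k ⟨by omega, h2, fun i _ _ => by omega⟩ (h.1.succ (by simp [h2]))
      | win => cases h4
      | lose => cases h4
    · rw [h1] at ih
      rw [h3]
      cases ih with
      | read r hr h =>
        have hresp := hr.isResponse h2
        by_cases hv : v = some 0
        · subst hv
          refine .unset ?_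
          rcases h with h | ⟨-, h⟩
          · exact h.succ (by simp [h2]) (by simp [h2])
          · exact absurd rfl (h.read_ne_zero hR hw hresp (SysHistory.atReg_eq_inv.mpr hr.2.1))
        · rw [resume_zero_of_ne p hv]
          refine .lose (h.imp (fun h => h.succ (by simp [h2]) (by simp [h2]))
            fun h h' => h.1 h'.of_succ) ?_
          exact ⟨r, k, p, none, v, hresp, by omega, SysHistory.atReg_eq_inv.mpr hr.2.1, .inr hv⟩
      | write r hr h =>
        exact .win (h.succ (by simp [h2])) ⟨r, k, p, some 1, v, hr.isResponse h2, by omega,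
          SysHistory.atReg_eq_inv.mpr hr.2.1, .inl (by simp)⟩
    · exact b.elim0
    · exact b.elim0
    · rw [h1] at ih
      rw [h3]
      refine .idle m (.inr ⟨fun h => h k (by omega) w h2, ?_⟩)
      cases ih with
      | start => cases h4
      | unset => cases h4
      | win h hs => exact hs.mono (by omega)
      | lose h hs => exact hs.mono (by omega)

end RegisterTestAndSet

open RegisterTestAndSet in
theorem registerTestAndSet_eventuallyImplements (n : ℕ) :
    (registerTestAndSet n).EventuallyImplements := by
  refine ⟨?_, ?_⟩
  · rintro ρ ⟨⟨c, hc⟩, -⟩ p k x hk hinf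
    -- The program counter in execution order: read call, read reply, write call, write reply,
    -- return. The last value ranks waiting states that do not occur but that `LocalStep` permits.
    let rank : ℕ × Phase (Fin 1) (Fin 0) → ℕ := fun s => match s with
      | (0, .running) => 6
      | (1, .running) => 4
      | (_, .running) => 1
      | (0, _) => 5
      | (1, _) => 3
      | (_, _) => 2
    refine Program.IsRun.exists_response_of_rank (P := registerTestAndSet n) hc rank ?_ hk hinf
    intro s e s' h hs hs'
    cases h with
    | invoke m x => exact absurd rfl hs
    | callReg m a x h =>
      change ℕ at m
      match m, h with
      | 0, _ => exact Nat.lt_succ_self _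
      | 1, _ => exact Nat.lt_succ_self _
      | m + 2, h => simp [registerTestAndSet] at h
    | replyReg m a v =>
      change ℕ at m
      match m with
      | 0 =>
        by_cases hv : v = some 0
        · rw [hv, resume_zero_of_eq]
          exact (by decide : 4 < 5)
        · rw [resume_zero_of_ne p hv]
          exact (by decide : 1 < 5)
      | 1 => exact (by decide : 1 < 3)
      | m + 2 => exact (by decide : 1 < 2)
    | callObj m b x h => exact b.elim0
    | replyObj m b v => exact b.elim0
    | respond m v h => exact absurd rfl hs'
  · rintro ρ ⟨⟨c, hc⟩, hR, -⟩
    have hc : (registerTestAndSet n).IsRun ρ c := hc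
    have hR : (ρ.atReg 0 0).Linearizable := hR 0
    have hW := hc.wellFormed
    refine History.eventuallyLinearizable_testAndSet hW ?_ ?_
    -- An earlier operation of the same process would have responded before `k` was invoked, against
    -- `NoRes` in the winning state.
    · intro k m k' p x x' hr hk hk'
      by_contra! hlt
      obtain ⟨m', v, hm', hr'⟩ := hW.2 k' k p x' x hlt hk' hk
      have hr'' := hr
      obtain ⟨q, y, hy, hm, -⟩ := hr''
      obtain ⟨q', y', hy', hq', -⟩ := hr'
      obtain rfl : q = p := by
        simp only [hk, Option.some.injEq, Event.inv.injEq] at hy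
        exact hy.1.symm
      obtain rfl : q' = q := by
        simp only [hk', Option.some.injEq, Event.inv.injEq] at hy'
        exact hy'.1.symm
      obtain ⟨w, h1, -, h2⟩ := hc.running_of_res (SysHistory.atTop_eq_some.mp hm)
      have hkn := known hc hR m q'
      rw [h1] at hkn
      have hq' := SysHistory.atTop_eq_some.mp hq'
      have := hr.lt
      cases hkn with
      | start => cases h2
      | unset => cases h2
      | win h => exact h m' (by omega) v hq'
      | lose => simp [registerTestAndSet] at h2
    · intro k m hr
      have hr' := hr
      obtain ⟨p, x, hk, hm, hkm, -⟩ := hr'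
      obtain ⟨w, h1, -, h2⟩ := hc.running_of_res (SysHistory.atTop_eq_some.mp hm)
      have hkn := known hc hR m p
      rw [h1] at hkn
      cases hkn with
      | start => cases h2
      | unset => cases h2
      | win => simp [registerTestAndSet] at h2
      | lose h hs =>
        rcases h with h | h
        · obtain ⟨w, q, y, hwm, hw⟩ := hs.exists_write hR
          have hw := SysHistory.atReg_eq_inv.mp hw
          have hqp : q ≠ p := by
            rintro rfl
            exact h.2 w hwm _ _ hw
          obtain ⟨u, hu, -⟩ := hc.running_of_reg_inv hw
          obtain ⟨j, z, hj, hz, -⟩ := hc.exists_pending (k := w) (p := q) (by simp [hu])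
          refine ⟨j, q, z, by omega, ?_, hz⟩
          rintro rfl
          simp only [hk, Option.some.injEq, Event.inv.injEq] at hz
          exact hqp hz.1.symm
        · simp only [NoRes, not_forall, not_not] at h
          obtain ⟨j, hj, v, hv⟩ := h
          obtain ⟨k', hk'⟩ := hW.1 j p v (SysHistory.atTop_eq_some.mpr hv)
          obtain ⟨q, z, hz, -⟩ := id hk'
          refine ⟨k', q, z, by have := hk'.lt; omega, ?_, hz⟩
          rintro rfl
          have := (hr.unique hk').1
          omega

end EventualLin

namespace EventualLin

namespace Simulation

/-! ### Executions of two processes under a schedule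

Both processes invoke the same operation again and again. Each access to a base object is atomic.
A test-and-set base object answers `true` exactly to the first access of each process, so that it
does not help the processes to communicate. -/

variable {n : ℕ} {V : Type} [Primcodable V] (P : Program n ℕ ℕ TestAndSet (FetchAndCons V))
  (pr : Bool → Fin n) (v₀ : V)

/-- The local state of a process: its memory, whether it is idle, the test-and-set objects that it
has used, and the responses of its operations. -/
structure Local where
  mem : P.Mem
  idle : Bool
  used : ℕ → Bool
  log : List (List V)

/-- The next step of process `b`. -/
def act (b : Bool) (l : Local P) : Action (Local P) :=
  if l.idle then .loc { l with mem := P.start (pr b) l.mem v₀, idle := false }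
  else match P.next (pr b) l.mem with
  | .inr v => .loc { l with idle := true, log := l.log ++ [v] }
  | .inl (.inl (a, none)) =>
    .read a fun x => { l with mem := P.resume (pr b) l.mem (.inl (some x)) }
  | .inl (.inl (a, some w)) => .write a w { l with mem := P.resume (pr b) l.mem (.inl none) }
  | .inl (.inr (o, _)) =>
    .loc { l with
      mem := P.resume (pr b) l.mem (.inr (!l.used o))
      used := Function.update l.used o true }

/-- The initial configuration. -/
def init : Config (Local P) where
  loc b := ⟨P.memInit (pr b), true, fun _ => false, []⟩
  reg := P.regInit

/-- The configuration after `k` steps under the schedule `s`. -/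
def conf (s : ℕ → Bool) (k : ℕ) : Config (Local P) :=
  Config.run (act P pr v₀) (init P pr) s k

/-- The first event of a step. -/
def firstEvent (b : Bool) (l : Local P) : SysEvent n ℕ ℕ TestAndSet (FetchAndCons V) :=
  if l.idle then .top (.inv (pr b) v₀)
  else match P.next (pr b) l.mem with
  | .inr v => .top (.res (pr b) v)
  | .inl (.inl (a, x)) => .reg a (.inv (pr b) x)
  | .inl (.inr (o, x)) => .obj o (.inv (pr b) x)

/-- The second event of a step, which is the response of a base object. -/
def secondEvent (b : Bool) (l : Local P) (reg : ℕ → ℕ) :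
    Option (SysEvent n ℕ ℕ TestAndSet (FetchAndCons V)) :=
  if l.idle then none
  else match P.next (pr b) l.mem with
  | .inr _ => none
  | .inl (.inl (a, none)) => some (.reg a (.res (pr b) (some (reg a))))
  | .inl (.inl (a, some _)) => some (.reg a (.res (pr b) none))
  | .inl (.inr (o, _)) => some (.obj o (.res (pr b) (!l.used o)))

/-- The state of the program between the two events of a step. -/
def midState (b : Bool) (l : Local P) : P.Mem × Phase ℕ ℕ :=
  if l.idle then (P.start (pr b) l.mem v₀, .running)
  else match P.next (pr b) l.mem with
  | .inr _ => (l.mem, .idle)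
  | .inl (.inl (a, _)) => (l.mem, .waitReg a)
  | .inl (.inr (o, _)) => (l.mem, .waitObj o)

/-- The state of the program between two steps. -/
def Local.state {P : Program n ℕ ℕ TestAndSet (FetchAndCons V)} (l : Local P) :
    P.Mem × Phase ℕ ℕ :=
  (l.mem, if l.idle then .idle else .running)

/-- The history of the system: step `k` takes place at the instants `2 * k` and `2 * k + 1`. -/
def hist (s : ℕ → Bool) : SysHistory n ℕ ℕ TestAndSet (FetchAndCons V) := fun i =>
  let C := conf P pr v₀ s (i / 2)
  if i % 2 = 0 then some (firstEvent P pr v₀ (s (i / 2)) (C.loc (s (i / 2))))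
  else secondEvent P pr (s (i / 2)) (C.loc (s (i / 2))) C.reg

open Classical in
/-- The states of the processes of the program. -/
noncomputable def states (s : ℕ → Bool) (i : ℕ) (p : Fin n) : P.Mem × Phase ℕ ℕ :=
  if h : ∃ b, pr b = p then
    if i % 2 = 1 ∧ s (i / 2) = h.choose then
      midState P pr v₀ h.choose ((conf P pr v₀ s (i / 2)).loc h.choose)
    else ((conf P pr v₀ s (i / 2)).loc h.choose).state
  else (P.memInit p, .idle)

variable {P pr v₀} {s : ℕ → Bool}

/-- The five kinds of steps. -/
theorem step_cases (C : Config (Local P)) (b : Bool) :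
    ((C.loc b).idle = true ∧ firstEvent P pr v₀ b (C.loc b) = .top (.inv (pr b) v₀) ∧
      secondEvent P pr b (C.loc b) C.reg = none ∧
      midState P pr v₀ b (C.loc b) = (P.start (pr b) (C.loc b).mem v₀, .running) ∧
      (C.step (act P pr v₀) b).loc b =
        { C.loc b with mem := P.start (pr b) (C.loc b).mem v₀, idle := false } ∧
      (C.step (act P pr v₀) b).reg = C.reg) ∨
    (∃ v, (C.loc b).idle = false ∧ P.next (pr b) (C.loc b).mem = .inr v ∧
      firstEvent P pr v₀ b (C.loc b) = .top (.res (pr b) v) ∧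
      secondEvent P pr b (C.loc b) C.reg = none ∧
      midState P pr v₀ b (C.loc b) = ((C.loc b).mem, .idle) ∧
      (C.step (act P pr v₀) b).loc b =
        { C.loc b with idle := true, log := (C.loc b).log ++ [v] } ∧
      (C.step (act P pr v₀) b).reg = C.reg) ∨
    (∃ a, (C.loc b).idle = false ∧ P.next (pr b) (C.loc b).mem = .inl (.inl (a, none)) ∧
      firstEvent P pr v₀ b (C.loc b) = .reg a (.inv (pr b) none) ∧
      secondEvent P pr b (C.loc b) C.reg = some (.reg a (.res (pr b) (some (C.reg a)))) ∧
      midState P pr v₀ b (C.loc b) = ((C.loc b).mem, .waitReg a) ∧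
      (C.step (act P pr v₀) b).loc b =
        { C.loc b with mem := P.resume (pr b) (C.loc b).mem (.inl (some (C.reg a))) } ∧
      (C.step (act P pr v₀) b).reg = C.reg) ∨
    (∃ a w, (C.loc b).idle = false ∧ P.next (pr b) (C.loc b).mem = .inl (.inl (a, some w)) ∧
      firstEvent P pr v₀ b (C.loc b) = .reg a (.inv (pr b) (some w)) ∧
      secondEvent P pr b (C.loc b) C.reg = some (.reg a (.res (pr b) none)) ∧
      midState P pr v₀ b (C.loc b) = ((C.loc b).mem, .waitReg a) ∧
      (C.step (act P pr v₀) b).loc b =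
        { C.loc b with mem := P.resume (pr b) (C.loc b).mem (.inl none) } ∧
      (C.step (act P pr v₀) b).reg = Function.update C.reg a w) ∨
    (∃ o, (C.loc b).idle = false ∧ P.next (pr b) (C.loc b).mem = .inl (.inr (o, ())) ∧
      firstEvent P pr v₀ b (C.loc b) = .obj o (.inv (pr b) ()) ∧
      secondEvent P pr b (C.loc b) C.reg = some (.obj o (.res (pr b) (!(C.loc b).used o))) ∧
      midState P pr v₀ b (C.loc b) = ((C.loc b).mem, .waitObj o) ∧
      (C.step (act P pr v₀) b).loc b =
        { C.loc b with
          mem := P.resume (pr b) (C.loc b).mem (.inr (!(C.loc b).used o))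
          used := Function.update (C.loc b).used o true } ∧
      (C.step (act P pr v₀) b).reg = C.reg) := by
  cases hidle : (C.loc b).idle with
  | true =>
    simp [hidle, firstEvent, secondEvent, midState, Config.step, act, Config.result,
      Config.update]
  | false =>
    right
    rcases hnext : P.next (pr b) (C.loc b).mem with (⟨a, _ | w⟩ | ⟨o, ⟨⟩⟩) | v
    · exact .inr (.inl ⟨a, by simp [hidle, hnext, firstEvent, secondEvent, midState, Config.step,
        act, Config.result, Config.update]⟩)
    · exact .inr (.inr (.inl ⟨a, w, by simp [hidle, hnext, firstEvent, secondEvent, midState,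
        Config.step, act, Config.result, Config.update]⟩))
    · exact .inr (.inr (.inr ⟨o, by simp [hidle, hnext, firstEvent, secondEvent, midState,
        Config.step, act, Config.result, Config.update]⟩))
    · exact .inl ⟨v, by simp [hidle, hnext, firstEvent, secondEvent, midState, Config.step,
        act, Config.result, Config.update]⟩

theorem conf_succ (k : ℕ) :
    conf P pr v₀ s (k + 1) = (conf P pr v₀ s k).step (act P pr v₀) (s k) := rfl

theorem conf_congr {s' : ℕ → Bool} {k : ℕ} (h : ∀ i < k, s i = s' i) :
    conf P pr v₀ s k = conf P pr v₀ s' k :=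
  Config.run_congr h

theorem hist_even (k : ℕ) :
    hist P pr v₀ s (2 * k) = some (firstEvent P pr v₀ (s k) ((conf P pr v₀ s k).loc (s k))) := by
  simp [hist]

theorem hist_odd (k : ℕ) :
    hist P pr v₀ s (2 * k + 1) =
      secondEvent P pr (s k) ((conf P pr v₀ s k).loc (s k)) (conf P pr v₀ s k).reg := by
  simp [hist, show (2 * k + 1) / 2 = k by omega]

theorem states_even (hpr : pr.Injective) (k : ℕ) (b : Bool) :
    states P pr v₀ s (2 * k) (pr b) = ((conf P pr v₀ s k).loc b).state := by
  have h : ∃ b', pr b' = pr b := ⟨b, rfl⟩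
  simp [states, hpr h.choose_spec]

theorem states_odd (hpr : pr.Injective) (k : ℕ) (b : Bool) :
    states P pr v₀ s (2 * k + 1) (pr b) =
      if s k = b then midState P pr v₀ b ((conf P pr v₀ s k).loc b)
      else ((conf P pr v₀ s k).loc b).state := by
  have h : ∃ b', pr b' = pr b := ⟨b, rfl⟩
  simp [states, hpr h.choose_spec, show (2 * k + 1) / 2 = k by omega]

theorem states_other {p : Fin n} (hp : ∀ b, pr b ≠ p) (k : ℕ) :
    states P pr v₀ s k p = (P.memInit p, .idle) := by
  simp [states, hp]

theorem firstEvent_proc (b : Bool) (l : Local P) : (firstEvent P pr v₀ b l).proc = pr b := by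
  unfold firstEvent
  split_ifs
  · rfl
  · split <;> rfl

theorem isRun (hpr : pr.Injective) : P.IsRun (hist P pr v₀ s) (states P pr v₀ s) := by
  refine ⟨fun p => ?_, fun i => ?_⟩
  · by_cases hp : ∃ b, pr b = p
    · obtain ⟨b, rfl⟩ := hp
      exact states_even hpr 0 b
    · exact states_other (not_exists.mp hp) 0
  · have hother : ∀ k b, s k ≠ b →
        states P pr v₀ s (2 * k + 1) (pr b) = states P pr v₀ s (2 * k) (pr b) ∧
        states P pr v₀ s (2 * (k + 1)) (pr b) = states P pr v₀ s (2 * k + 1) (pr b) := by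
      intro k b hb
      rw [states_even hpr, states_even hpr, states_odd hpr, if_neg hb, conf_succ,
        Config.step_loc_of_ne (Ne.symm hb)]
      exact ⟨rfl, rfl⟩
    have hself : ∀ k, states P pr v₀ s (2 * k + 1) (pr (s k)) =
        midState P pr v₀ (s k) ((conf P pr v₀ s k).loc (s k)) := by
      intro k
      rw [states_odd hpr, if_pos rfl]
    have hunchanged : ∀ i j, (∀ b, states P pr v₀ s i (pr b) = states P pr v₀ s j (pr b)) →
        ∀ q, states P pr v₀ s i q = states P pr v₀ s j q := by
      intro i j h q
      by_cases hq : ∃ b, pr b = q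
      · obtain ⟨b, rfl⟩ := hq
        exact h b
      · rw [states_other (not_exists.mp hq), states_other (not_exists.mp hq)]
    have hunchanged' : ∀ i j k,
        (∀ b, s k ≠ b → states P pr v₀ s i (pr b) = states P pr v₀ s j (pr b)) →
        ∀ q, q ≠ pr (s k) → states P pr v₀ s i q = states P pr v₀ s j q := by
      intro i j k h q hne
      by_cases hq : ∃ b, pr b = q
      · obtain ⟨b, rfl⟩ := hq
        exact h b fun hb => hne (by rw [hb])
      · rw [states_other (not_exists.mp hq), states_other (not_exists.mp hq)]
    rcases Nat.even_or_odd' i with ⟨k, rfl | rfl⟩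
    · rw [hist_even]
      refine ⟨fun h => by simp at h, fun e he => ?_⟩
      obtain rfl := Option.some.inj he
      rw [firstEvent_proc]
      refine ⟨?_, hunchanged' _ _ k fun b hb => (hother k b hb).1⟩
      rw [hself, states_even hpr]
      rcases step_cases (pr := pr) (v₀ := v₀) (conf P pr v₀ s k) (s k) with
        ⟨h1, h2, h3, h4, h5, h6⟩ | ⟨v, h1, h2, h3, h4, h5, h6, h7⟩ |
        ⟨a, h1, h2, h3, h4, h5, h6, h7⟩ | ⟨a, w, h1, h2, h3, h4, h5, h6, h7⟩ |
        ⟨o, h1, h2, h3, h4, h5, h6, h7⟩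
      · rw [h2, h4, Local.state, h1]
        exact .invoke _ _
      · rw [h3, h5, Local.state, h1]
        exact .respond _ _ h2
      · rw [h3, h5, Local.state, h1]
        exact .callReg _ _ _ h2
      · rw [h3, h5, Local.state, h1]
        exact .callReg _ _ _ h2
      · rw [h3, h5, Local.state, h1]
        exact .callObj _ _ _ h2
    · rw [hist_odd, show 2 * k + 1 + 1 = 2 * (k + 1) by omega]
      have hnext : states P pr v₀ s (2 * (k + 1)) (pr (s k)) =
          (((conf P pr v₀ s k).step (act P pr v₀) (s k)).loc (s k)).state :=
        states_even hpr (k + 1) (s k)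
      have hnone : states P pr v₀ s (2 * (k + 1)) (pr (s k)) =
          states P pr v₀ s (2 * k + 1) (pr (s k)) →
          states P pr v₀ s (2 * (k + 1)) = states P pr v₀ s (2 * k + 1) := by
        intro h
        funext q
        refine hunchanged _ _ (fun b => ?_) q
        by_cases hb : s k = b
        · rw [← hb, h]
        · exact (hother k b hb).2
      have hsome := hunchanged' (2 * (k + 1)) (2 * k + 1) k fun b hb => (hother k b hb).2
      rcases step_cases (pr := pr) (v₀ := v₀) (conf P pr v₀ s k) (s k) with
        ⟨h1, h2, h3, h4, h5, h6⟩ | ⟨v, h1, h2, h3, h4, h5, h6, h7⟩ |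
        ⟨a, h1, h2, h3, h4, h5, h6, h7⟩ | ⟨a, w, h1, h2, h3, h4, h5, h6, h7⟩ |
        ⟨o, h1, h2, h3, h4, h5, h6, h7⟩
      · refine ⟨fun _ => hnone ?_, fun e he => by simp [h3] at he⟩
        rw [hnext, hself, h4, h5]
        simp [Local.state]
      · refine ⟨fun _ => hnone ?_, fun e he => by simp [h4] at he⟩
        rw [hnext, hself, h5, h6]
        simp [Local.state]
      · refine ⟨fun he => by simp [h4] at he, fun e he => ?_⟩
        obtain rfl := Option.some.inj (h4.symm.trans he)
        refine ⟨?_, hsome⟩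
        change P.LocalStep (pr (s k)) (states P pr v₀ s (2 * k + 1) (pr (s k))) _
          (states P pr v₀ s (2 * (k + 1)) (pr (s k)))
        rw [hnext, hself, h5, h6]
        simp only [Local.state, h1]
        exact .replyReg _ _ _
      · refine ⟨fun he => by simp [h4] at he, fun e he => ?_⟩
        obtain rfl := Option.some.inj (h4.symm.trans he)
        refine ⟨?_, hsome⟩
        change P.LocalStep (pr (s k)) (states P pr v₀ s (2 * k + 1) (pr (s k))) _
          (states P pr v₀ s (2 * (k + 1)) (pr (s k)))
        rw [hnext, hself, h5, h6]
        simp only [Local.state, h1]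
        exact .replyReg _ _ _
      · refine ⟨fun he => by simp [h4] at he, fun e he => ?_⟩
        obtain rfl := Option.some.inj (h4.symm.trans he)
        refine ⟨?_, hsome⟩
        change P.LocalStep (pr (s k)) (states P pr v₀ s (2 * k + 1) (pr (s k))) _
          (states P pr v₀ s (2 * (k + 1)) (pr (s k)))
        rw [hnext, hself, h5, h6]
        simp only [Local.state, h1]
        exact .replyObj _ _ _

/-- Each access occupies two consecutive instants, so the register contents in `conf` serve as the
states of a linearization. -/
theorem atReg_linearizable (a : ℕ) :
    ((hist P pr v₀ s).atReg a (P.regInit a)).Linearizable := by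
  refine History.linearizable_of_atomic (fun k => (conf P pr v₀ s k).reg a) rfl fun k => ?_
  have he := hist_even (P := P) (pr := pr) (v₀ := v₀) (s := s) k
  have ho := hist_odd (P := P) (pr := pr) (v₀ := v₀) (s := s) k
  rw [conf_succ]
  rcases step_cases (pr := pr) (v₀ := v₀) (conf P pr v₀ s k) (s k) with
    ⟨h1, h2, h3, h4, h5, h6⟩ | ⟨v, h1, h2, h3, h4, h5, h6, h7⟩ |
    ⟨a', h1, h2, h3, h4, h5, h6, h7⟩ | ⟨a', w, h1, h2, h3, h4, h5, h6, h7⟩ |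
    ⟨o, h1, h2, h3, h4, h5, h6, h7⟩
  · rw [h2] at he
    rw [h3] at ho
    exact .inl ⟨by simp [SysHistory.atReg, he], by simp [SysHistory.atReg, ho], by rw [h6]⟩
  · rw [h3] at he
    rw [h4] at ho
    exact .inl ⟨by simp [SysHistory.atReg, he], by simp [SysHistory.atReg, ho], by rw [h7]⟩
  · rw [h3] at he
    rw [h4] at ho
    by_cases ha : a' = a
    · subst ha
      exact .inr ⟨_, _, _, SysHistory.atReg_eq_inv.mpr he, SysHistory.atReg_eq_res.mpr ho,
        by simp [h7]⟩
    · exact .inl ⟨by simp [SysHistory.atReg, he, ha], by simp [SysHistory.atReg, ho, ha],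
        by rw [h7]⟩
  · rw [h3] at he
    rw [h4] at ho
    by_cases ha : a' = a
    · subst ha
      exact .inr ⟨_, _, _, SysHistory.atReg_eq_inv.mpr he, SysHistory.atReg_eq_res.mpr ho,
        by simp [h7]⟩
    · exact .inl ⟨by simp [SysHistory.atReg, he, ha], by simp [SysHistory.atReg, ho, ha],
        by simp [h7, Ne.symm ha]⟩
  · rw [h3] at he
    rw [h4] at ho
    exact .inl ⟨by simp [SysHistory.atReg, he], by simp [SysHistory.atReg, ho], by rw [h7]⟩

/-- This ties the flag that determines the answers of object `o` to the accesses in the history. -/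
theorem used_iff (o k : ℕ) (b : Bool) :
    ((conf P pr v₀ s k).loc b).used o = true ↔
      ∃ j < k, s j = b ∧ hist P pr v₀ s (2 * j) = some (.obj o (.inv (pr b) ())) := by
  induction k with
  | zero => simp [conf, Config.run, init]
  | succ k ih =>
    have hsucc : (∃ j < k + 1, s j = b ∧ hist P pr v₀ s (2 * j) = some (.obj o (.inv (pr b) ()))) ↔
        ((conf P pr v₀ s k).loc b).used o = true ∨
          (s k = b ∧ hist P pr v₀ s (2 * k) = some (.obj o (.inv (pr b) ()))) := by
      rw [ih]
      constructor
      · rintro ⟨j, hj, h⟩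
        rcases Nat.lt_succ_iff_lt_or_eq.mp hj with hj | rfl
        · exact .inl ⟨j, hj, h⟩
        · exact .inr h
      · rintro (⟨j, hj, h⟩ | h)
        · exact ⟨j, by omega, h⟩
        · exact ⟨k, by omega, h⟩
    rw [hsucc, conf_succ]
    by_cases hb : s k = b
    swap
    · rw [Config.step_loc_of_ne (Ne.symm hb)]
      simp [hb]
    subst hb
    rw [hist_even]
    rcases step_cases (pr := pr) (v₀ := v₀) (conf P pr v₀ s k) (s k) with
      ⟨h1, h2, h3, h4, h5, h6⟩ | ⟨v, h1, h2, h3, h4, h5, h6, h7⟩ |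
      ⟨a', h1, h2, h3, h4, h5, h6, h7⟩ | ⟨a', w, h1, h2, h3, h4, h5, h6, h7⟩ |
      ⟨o', h1, h2, h3, h4, h5, h6, h7⟩
    · simp [h5, h2]
    · simp [h6, h3]
    · simp [h6, h3]
    · simp [h6, h3]
    · by_cases ho : o' = o
      · subst ho
        simp [h6, h3]
      · simp [h6, h3, ho, Function.update_of_ne (Ne.symm ho)]

/-- A process wins only at its first access and loses only after an earlier access of its own, which
is all that `eventuallyLinearizable_testAndSet` demands. -/
theorem atObj_eventuallyLinearizable (hpr : pr.Injective) (o : ℕ) :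
    ((hist P pr v₀ s).atObj o (P.objInit o)).EventuallyLinearizable := by
  have h0 : P.objInit o = false := P.objInit_mem o
  rw [h0]
  have hcase : ∀ k, ((hist P pr v₀ s).atObj o false (2 * k) = none ∧
        (hist P pr v₀ s).atObj o false (2 * k + 1) = none) ∨
      (hist P pr v₀ s (2 * k) = some (.obj o (.inv (pr (s k)) ())) ∧
        (hist P pr v₀ s).atObj o false (2 * k) = some (.inv (pr (s k)) ()) ∧
        (hist P pr v₀ s).atObj o false (2 * k + 1) =
          some (.res (pr (s k)) (!((conf P pr v₀ s k).loc (s k)).used o))) := by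
    intro k
    have he := hist_even (P := P) (pr := pr) (v₀ := v₀) (s := s) k
    have ho := hist_odd (P := P) (pr := pr) (v₀ := v₀) (s := s) k
    rcases step_cases (pr := pr) (v₀ := v₀) (conf P pr v₀ s k) (s k) with
      ⟨h1, h2, h3, h4, h5, h6⟩ | ⟨v, h1, h2, h3, h4, h5, h6, h7⟩ |
      ⟨a', h1, h2, h3, h4, h5, h6, h7⟩ | ⟨a', w, h1, h2, h3, h4, h5, h6, h7⟩ |
      ⟨o', h1, h2, h3, h4, h5, h6, h7⟩
    · rw [h2] at he
      rw [h3] at ho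
      exact .inl ⟨by simp [SysHistory.atObj, he], by simp [SysHistory.atObj, ho]⟩
    · rw [h3] at he
      rw [h4] at ho
      exact .inl ⟨by simp [SysHistory.atObj, he], by simp [SysHistory.atObj, ho]⟩
    · rw [h3] at he
      rw [h4] at ho
      exact .inl ⟨by simp [SysHistory.atObj, he], by simp [SysHistory.atObj, ho]⟩
    · rw [h3] at he
      rw [h4] at ho
      exact .inl ⟨by simp [SysHistory.atObj, he], by simp [SysHistory.atObj, ho]⟩
    · rw [h3] at he
      rw [h4] at ho
      by_cases ha : o' = o
      · subst ha
        exact .inr ⟨he, SysHistory.atObj_eq_inv.mpr he, SysHistory.atObj_eq_res.mpr ho⟩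
      · exact .inl ⟨by simp [SysHistory.atObj, he, ha], by simp [SysHistory.atObj, ho, ha]⟩
  have hinv : ∀ i p x, (hist P pr v₀ s).atObj o false i = some (.inv p x) →
      ∃ k, i = 2 * k ∧ p = pr (s k) ∧
        hist P pr v₀ s (2 * k) = some (.obj o (.inv (pr (s k)) ())) := by
    intro i p x hi
    rcases Nat.even_or_odd' i with ⟨k, rfl | rfl⟩ <;> rcases hcase k with h | ⟨h1, h2, h3⟩
    · simp [h.1] at hi
    · simp only [h2, Option.some.injEq, Event.inv.injEq] at hi
      exact ⟨k, rfl, hi.1.symm, h1⟩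
    · simp [h.2] at hi
    · simp [h3] at hi
  have hres : ∀ i m v, ((hist P pr v₀ s).atObj o false).IsResponse i m v → ∃ k, i = 2 * k ∧
      m = 2 * k + 1 ∧ v = !((conf P pr v₀ s k).loc (s k)).used o := by
    intro i m v hr
    obtain ⟨p, x, hi, hm, -⟩ := id hr
    rcases Nat.even_or_odd' m with ⟨k, rfl | rfl⟩ <;> rcases hcase k with h | ⟨h1, h2, h3⟩
    · simp [h.1] at hm
    · simp [h2] at hm
    · simp [h.2] at hm
    · have hr' : ((hist P pr v₀ s).atObj o false).IsResponse (2 * k) (2 * k + 1) _ :=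
        ⟨_, _, h2, h3, by omega, fun j _ _ => by omega⟩
      obtain rfl := hr.op_unique hr'
      exact ⟨k, rfl, rfl, (hr.unique hr').2⟩
  refine History.eventuallyLinearizable_testAndSet
    (History.wellFormed_of_atomic fun k => (hcase k).imp id ?_) ?_ ?_
  · rintro ⟨-, h2, h3⟩
    exact ⟨_, _, _, h2, h3⟩
  · intro i m i' p x x' hr hi hi'
    obtain ⟨k, rfl, rfl, hv⟩ := hres i m _ hr
    obtain ⟨k₁, hk₁, hp, -⟩ := hinv _ p x hi
    obtain rfl : k = k₁ := by omega
    obtain ⟨k', rfl, hp', h⟩ := hinv i' p x' hi'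
    by_contra! hlt
    have hs : s k' = s k := hpr (hp'.symm.trans hp)
    have := (used_iff (P := P) (pr := pr) (v₀ := v₀) (s := s) o k (s k)).mpr
      ⟨k', by omega, hs, by rw [← hs]; exact h⟩
    simp [this] at hv
  · intro i m hr
    obtain ⟨k, rfl, rfl, hv⟩ := hres i m _ hr
    have hu : ((conf P pr v₀ s k).loc (s k)).used o = true := by
      cases h : ((conf P pr v₀ s k).loc (s k)).used o
      · rw [h] at hv
        cases hv
      · rfl
    obtain ⟨j, hj, -, h⟩ := (used_iff o k (s k)).mp hu
    exact ⟨2 * j, _, (), by omega, by omega, SysHistory.atObj_eq_inv.mpr h⟩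

theorem isExecution (hpr : pr.Injective) (s : ℕ → Bool) : P.IsExecution (hist P pr v₀ s) :=
  ⟨⟨_, isRun hpr⟩, atReg_linearizable, atObj_eventuallyLinearizable hpr⟩

/-! ### The history of the implemented object -/

theorem atTop_odd (k : ℕ) : (hist P pr v₀ s).atTop (2 * k + 1) = none := by
  have ho := hist_odd (P := P) (pr := pr) (v₀ := v₀) (s := s) k
  rcases step_cases (pr := pr) (v₀ := v₀) (conf P pr v₀ s k) (s k) with
    ⟨h1, h2, h3, h4, h5, h6⟩ | ⟨v, h1, h2, h3, h4, h5, h6, h7⟩ |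
    ⟨a', h1, h2, h3, h4, h5, h6, h7⟩ | ⟨a', w, h1, h2, h3, h4, h5, h6, h7⟩ |
    ⟨o', h1, h2, h3, h4, h5, h6, h7⟩
  · simp [SysHistory.atTop, ho, h3]
  all_goals simp [SysHistory.atTop, ho, h4]

theorem exists_step_of_atTop {i : ℕ} {e : Event n (FetchAndCons V)}
    (h : (hist P pr v₀ s).atTop i = some e) : ∃ k, i = 2 * k ∧ e.proc = pr (s k) := by
  rcases Nat.even_or_odd' i with ⟨k, rfl | rfl⟩
  · refine ⟨k, rfl, ?_⟩
    have he := SysHistory.atTop_eq_some.mp h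
    rw [hist_even, Option.some.injEq] at he
    have := firstEvent_proc (pr := pr) (v₀ := v₀) (s k) ((conf P pr v₀ s k).loc (s k))
    rw [he] at this
    exact this
  · simp [atTop_odd] at h

/-- What a step changes at process `b`, as far as the implemented object is concerned. -/
theorem step_top_cases (s : ℕ → Bool) (k : ℕ) (b : Bool) :
    (s k ≠ b ∧ (conf P pr v₀ s (k + 1)).loc b = (conf P pr v₀ s k).loc b) ∨
    (s k = b ∧ ((conf P pr v₀ s k).loc b).idle = true ∧
      (hist P pr v₀ s).atTop (2 * k) = some (.inv (pr b) v₀) ∧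
      ((conf P pr v₀ s (k + 1)).loc b).idle = false ∧
      ((conf P pr v₀ s (k + 1)).loc b).log = ((conf P pr v₀ s k).loc b).log) ∨
    (∃ v, s k = b ∧ ((conf P pr v₀ s k).loc b).idle = false ∧
      (hist P pr v₀ s).atTop (2 * k) = some (.res (pr b) v) ∧
      ((conf P pr v₀ s (k + 1)).loc b).idle = true ∧
      ((conf P pr v₀ s (k + 1)).loc b).log = ((conf P pr v₀ s k).loc b).log ++ [v]) ∨
    (s k = b ∧ ((conf P pr v₀ s k).loc b).idle = false ∧
      (hist P pr v₀ s).atTop (2 * k) = none ∧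
      ((conf P pr v₀ s (k + 1)).loc b).idle = false ∧
      ((conf P pr v₀ s (k + 1)).loc b).log = ((conf P pr v₀ s k).loc b).log) := by
  rw [conf_succ]
  by_cases hb : s k = b
  swap
  · exact .inl ⟨hb, Config.step_loc_of_ne (Ne.symm hb) _⟩
  subst hb
  right
  have he := hist_even (P := P) (pr := pr) (v₀ := v₀) (s := s) k
  rcases step_cases (pr := pr) (v₀ := v₀) (conf P pr v₀ s k) (s k) with
    ⟨h1, h2, h3, h4, h5, h6⟩ | ⟨v, h1, h2, h3, h4, h5, h6, h7⟩ |
    ⟨a', h1, h2, h3, h4, h5, h6, h7⟩ | ⟨a', w, h1, h2, h3, h4, h5, h6, h7⟩ |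
    ⟨o', h1, h2, h3, h4, h5, h6, h7⟩
  · exact .inl ⟨rfl, h1, SysHistory.atTop_eq_some.mpr (by rw [he, h2]), by simp [h5], by simp [h5]⟩
  · exact .inr (.inl ⟨v, rfl, h1, SysHistory.atTop_eq_some.mpr (by rw [he, h3]), by simp [h6],
      by simp [h6]⟩)
  all_goals
    exact .inr (.inr ⟨rfl, h1, by simp [SysHistory.atTop, he, h3], by simp [h6, h1],
      by simp [h6]⟩)

end Simulation

end EventualLin

namespace EventualLin

/-! ### Dependence on finite prefixes, and splicing of schedules. -/

namespace History

variable {n : ℕ}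

theorem IsResponse.congr {T : DataType} {H H' : History n T} {N k m : ℕ} {v : T.Res}
    (h : H.IsResponse k m v) (hm : m < N) (hH : ∀ i < N, H i = H' i) : H'.IsResponse k m v := by
  obtain ⟨p, x, h1, h2, h3, h4⟩ := h
  exact ⟨p, x, by rw [← hH k (by omega), h1], by rw [← hH m hm, h2], h3,
    fun j hkj hjm e he => h4 j hkj hjm e (by rw [hH j (by omega), he])⟩

/-- Being an anchor concerns only the instants up to `e`, so it survives every change of the future.
-/
theorem IsAnchor.congr {V : Type} [Primcodable V] {H H' : History n (FetchAndCons V)}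
    {N a e : ℕ} {L : List V} (h : H.IsAnchor a e L) (he : e < N) (hH : ∀ i < N, H i = H' i) :
    H'.IsAnchor a e L := by
  have hae := h.resp.lt
  refine ⟨h.resp.congr he hH, fun k p x hak hke => ?_, ?_⟩
  · rw [← hH k (by omega)]
    exact h.alone k p x hak hke
  · rw [h.length]
    congr 1
    ext k
    rw [mem_invsBefore, mem_invsBefore]
    constructor
    · rintro ⟨hk, hx⟩
      exact ⟨hk, by rwa [← hH k (by omega)]⟩
    · rintro ⟨hk, hx⟩
      exact ⟨hk, by rwa [hH k (by omega)]⟩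

end History

namespace Simulation

variable {n : ℕ} {V : Type} [Primcodable V] {P : Program n ℕ ℕ TestAndSet (FetchAndCons V)}
  {pr : Bool → Fin n} {v₀ : V} {s s' : ℕ → Bool}

/-- The schedule that follows `s` for `K` steps and then continues with `s'`. -/
def splice (s : ℕ → Bool) (K : ℕ) (s' : ℕ → Bool) : ℕ → Bool := fun i =>
  if i < K then s i else s' (i - K)

theorem splice_of_lt {K i : ℕ} (h : i < K) : splice s K s' i = s i := if_pos h

theorem splice_of_le {K i : ℕ} (h : K ≤ i) : splice s K s' i = s' (i - K) := if_neg (by omega)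

theorem conf_splice_add (K k : ℕ) :
    conf P pr v₀ (splice s K s') (K + k) =
      Config.run (act P pr v₀) (conf P pr v₀ s K) s' k := by
  rw [conf, Config.run_add]
  congr 1
  · exact Config.run_congr fun i hi => splice_of_lt hi
  · funext i
    rw [splice_of_le (by omega)]
    congr 1
    omega

theorem hist_congr {K : ℕ} (h : ∀ i < K, s i = s' i) {i : ℕ} (hi : i < 2 * K) :
    hist P pr v₀ s i = hist P pr v₀ s' i := by
  have h1 : conf P pr v₀ s (i / 2) = conf P pr v₀ s' (i / 2) :=
    conf_congr fun j hj => h j (by omega)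
  simp only [hist, h1, h (i / 2) (by omega)]

theorem atTop_congr {K : ℕ} (h : ∀ i < K, s i = s' i) {i : ℕ} (hi : i < 2 * K) :
    (hist P pr v₀ s).atTop i = (hist P pr v₀ s').atTop i := by
  simp only [SysHistory.atTop, hist_congr h hi]

/-- A process that takes no steps keeps its local state. -/
theorem loc_eq_of_ne {K K' : ℕ} {b : Bool} (hK : K ≤ K')
    (h : ∀ i, K ≤ i → i < K' → s i ≠ b) :
    (conf P pr v₀ s K').loc b = (conf P pr v₀ s K).loc b := by
  induction K', hK using Nat.le_induction with
  | base => rfl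
  | succ k hk ih =>
    rw [conf_succ, Config.step_loc_of_ne (h k hk (by omega)).symm,
      ih fun i h1 h2 => h i h1 (by omega)]

theorem log_prefix {K K' : ℕ} {b : Bool} (hK : K ≤ K') :
    ((conf P pr v₀ s K).loc b).log <+: ((conf P pr v₀ s K').loc b).log := by
  induction K', hK using Nat.le_induction with
  | base => exact List.prefix_rfl
  | succ k hk ih =>
    refine ih.trans ?_
    rcases step_top_cases (P := P) (pr := pr) (v₀ := v₀) s k b with
      ⟨-, h⟩ | ⟨-, -, -, -, h⟩ | ⟨v, -, -, -, -, h⟩ | ⟨-, -, -, -, h⟩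
    · rw [h]
    · rw [h]
    · exact ⟨_, h.symm⟩
    · rw [h]

theorem log_step (C : Config (Local P)) (b b' : Bool) :
    (C.loc b).log <+: ((C.step (act P pr v₀) b').loc b).log := by
  by_cases hb : b = b'
  swap
  · rw [Config.step_loc_of_ne hb]
  subst hb
  rcases step_cases (pr := pr) (v₀ := v₀) C b with
    ⟨-, -, -, -, h, -⟩ | ⟨v, -, -, -, -, -, h, -⟩ | ⟨a, -, -, -, -, -, h, -⟩ |
    ⟨a, w, -, -, -, -, -, h, -⟩ | ⟨o, -, -, -, -, -, h, -⟩ <;> simp [h]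

/-- An operation gets its response with a step of its process, which is idle afterwards. -/
theorem step_of_isResponse {i m : ℕ} {L : List V} {b : Bool} {x : V} (hpr : pr.Injective)
    (h : (hist P pr v₀ s).atTop.IsResponse i m L)
    (hi : (hist P pr v₀ s).atTop i = some (.inv (pr b) x)) :
    ∃ j, m = 2 * j ∧ s j = b ∧ ((conf P pr v₀ s (j + 1)).loc b).idle = true ∧
      ((conf P pr v₀ s (j + 1)).loc b).log = ((conf P pr v₀ s j).loc b).log ++ [L] := by
  obtain ⟨p, y, hi', hm, -⟩ := h
  obtain rfl : p = pr b := by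
    simp only [hi, Option.some.injEq, Event.inv.injEq] at hi'
    exact hi'.1.symm
  obtain ⟨j, rfl, hj⟩ := exists_step_of_atTop hm
  have hs : s j = b := (hpr hj).symm
  refine ⟨j, rfl, hs, ?_⟩
  rcases step_top_cases (P := P) (pr := pr) (v₀ := v₀) s j b with
    ⟨h, -⟩ | ⟨-, -, h, -⟩ | ⟨v, -, -, h, h1, h2⟩ | ⟨-, -, h, -⟩
  · exact absurd hs h
  · simp [h] at hm
  · obtain rfl : v = L := by simpa [h] using hm
    exact ⟨h1, h2⟩
  · simp [h] at hm

theorem exists_response (hP : P.WaitFree) (hpr : pr.Injective) {b : Bool} {i : ℕ} {x : V}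
    (hi : (hist P pr v₀ s).atTop i = some (.inv (pr b) x)) (hinf : ∀ N, ∃ k, N ≤ k ∧ s k = b) :
    ∃ m L, (hist P pr v₀ s).atTop.IsResponse i m L := by
  refine hP _ (isExecution hpr s) (pr b) i x hi fun N => ?_
  obtain ⟨k, hk, hs⟩ := hinf N
  exact ⟨2 * k, by omega, _, hist_even k, by rw [firstEvent_proc, hs]⟩

theorem inv_of_idle {k : ℕ} (h : ((conf P pr v₀ s k).loc (s k)).idle = true) :
    (hist P pr v₀ s).atTop (2 * k) = some (.inv (pr (s k)) v₀) := by
  rcases step_top_cases (P := P) (pr := pr) (v₀ := v₀) s k (s k) with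
    ⟨h', -⟩ | ⟨-, -, h', -⟩ | ⟨v, -, h', -⟩ | ⟨-, h', -⟩
  · exact absurd rfl h'
  · exact h'
  · simp [h] at h'
  · simp [h] at h'

/-- A process that keeps taking steps becomes idle again and again. -/
theorem exists_idle (hP : P.WaitFree) (hpr : pr.Injective) {b : Bool}
    (hinf : ∀ N, ∃ k, N ≤ k ∧ s k = b) (K : ℕ) :
    ∃ K', K ≤ K' ∧ ((conf P pr v₀ s K').loc b).idle = true := by
  by_cases h : ((conf P pr v₀ s K).loc b).idle = true
  · exact ⟨K, le_rfl, h⟩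
  have hrun := isRun (P := P) (v₀ := v₀) (s := s) hpr
  obtain ⟨i, x, hi, hx, hbet⟩ := hrun.exists_pending (k := 2 * K) (p := pr b) (by
    rw [states_even hpr, Local.state]
    simp [h])
  obtain ⟨m, L, hr⟩ := exists_response hP hpr hx hinf
  obtain ⟨j, rfl, hj, hidle, -⟩ := step_of_isResponse hpr hr hx
  refine ⟨j + 1, ?_, hidle⟩
  by_contra! hlt
  obtain ⟨p, y, hy, hm, him, -⟩ := hr
  refine hbet (2 * j) him (by omega) _ hm ?_
  simp only [hx, Option.some.injEq, Event.inv.injEq] at hy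
  exact hy.1.symm

/-- The first operation that an idle process performs after step `K`. -/
theorem exists_first_response (hpr : pr.Injective) {K K' : ℕ} {b : Bool} {L : List V} (hK : K ≤ K')
    (hidle : ((conf P pr v₀ s K).loc b).idle = true)
    (hL : ((conf P pr v₀ s K').loc b).log[((conf P pr v₀ s K).loc b).log.length]? = some L) :
    ∃ k m, K ≤ k ∧ m < K' ∧ s k = b ∧ (hist P pr v₀ s).atTop.IsResponse (2 * k) (2 * m) L ∧
      ∀ j p x, K ≤ j → j < m → s j = b →
        (hist P pr v₀ s).atTop (2 * j) = some (.inv p x) → j = k := by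
  -- Three stages of `b` after step `K`: no step yet, first operation pending, first operation
  -- completed. The log entry at the old log length is the response of that operation.
  have key : (((conf P pr v₀ s K').loc b).idle = true ∧
      ((conf P pr v₀ s K').loc b).log = ((conf P pr v₀ s K).loc b).log ∧
      ∀ i, K ≤ i → i < K' → s i ≠ b) ∨
    (((conf P pr v₀ s K').loc b).idle = false ∧
      ((conf P pr v₀ s K').loc b).log = ((conf P pr v₀ s K).loc b).log ∧
      ∃ k, K ≤ k ∧ k < K' ∧ s k = b ∧
        (hist P pr v₀ s).atTop (2 * k) = some (.inv (pr b) v₀) ∧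
        ∀ i, K ≤ i → i < K' → s i = b → i ≠ k → (hist P pr v₀ s).atTop (2 * i) = none) ∨
    ∃ L, ((conf P pr v₀ s K').loc b).log[((conf P pr v₀ s K).loc b).log.length]? = some L ∧
      ∃ k m, K ≤ k ∧ m < K' ∧ s k = b ∧
        (hist P pr v₀ s).atTop.IsResponse (2 * k) (2 * m) L ∧
        ∀ j p x, K ≤ j → j < m → s j = b →
          (hist P pr v₀ s).atTop (2 * j) = some (.inv p x) → j = k := by
    clear hL
    induction K', hK using Nat.le_induction with
    | base => exact .inl ⟨hidle, rfl, fun i _ _ => by omega⟩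
    | succ K' hK ih =>
      rcases ih with ⟨h1, h2, h3⟩ | ⟨h1, h2, k, hk, hkK, hsk, hinv, h3⟩ |
        ⟨L, hL, k, m, hk, hm, hsk, hr, h3⟩
      · rcases step_top_cases (P := P) (pr := pr) (v₀ := v₀) s K' b with
          ⟨hs, h⟩ | ⟨hs, -, h, h4, h5⟩ | ⟨v, -, h, -⟩ | ⟨-, h, -⟩
        · refine .inl ⟨by rw [h, h1], by rw [h, h2], fun i hi hi' => ?_⟩
          rcases Nat.lt_succ_iff_lt_or_eq.mp hi' with hi' | rfl
          · exact h3 i hi hi'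
          · exact hs
        · refine .inr (.inl ⟨h4, by rw [h5, h2], K', hK, by omega, hs, h, fun i hi hi' hsi hne => ?_⟩)
          exact absurd hsi (h3 i hi (by omega))
        · simp [h1] at h
        · simp [h1] at h
      · rcases step_top_cases (P := P) (pr := pr) (v₀ := v₀) s K' b with
          ⟨hs, h⟩ | ⟨-, h, -⟩ | ⟨v, hs, -, h, h4, h5⟩ | ⟨hs, -, h, h4, h5⟩
        · refine .inr (.inl ⟨by rw [h, h1], by rw [h, h2], k, hk, by omega, hsk, hinv,
            fun i hi hi' hsi hne => ?_⟩)
          rcases Nat.lt_succ_iff_lt_or_eq.mp hi' with hi' | rfl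
          · exact h3 i hi hi' hsi hne
          · exact absurd hsi hs
        · simp [h1] at h
        · refine .inr (.inr ⟨v, by simp [h5, h2], k, K', hk, by omega, hsk,
            ⟨pr b, v₀, hinv, h, by omega, fun j hkj hjK e he hp => ?_⟩, fun j p x hj hj' hsj hx => ?_⟩)
          · obtain ⟨i, rfl, hi⟩ := exists_step_of_atTop he
            have hsi : s i = b := hpr (hi.symm.trans hp)
            simp [h3 i (by omega) (by omega) hsi (by omega)] at he
          · by_contra hne
            simp [h3 j hj hj' hsj hne] at hx
        · refine .inr (.inl ⟨h4, by rw [h5, h2], k, hk, by omega, hsk, hinv,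
            fun i hi hi' hsi hne => ?_⟩)
          rcases Nat.lt_succ_iff_lt_or_eq.mp hi' with hi' | rfl
          · exact h3 i hi hi' hsi hne
          · exact h
      · refine .inr (.inr ⟨L, ?_, k, m, hk, by omega, hsk, hr, h3⟩)
        obtain ⟨l, hl⟩ := log_prefix (P := P) (pr := pr) (v₀ := v₀) (s := s) (b := b)
          (Nat.le_succ K')
        rw [← hl, List.getElem?_append_left (List.getElem?_eq_some_iff.mp hL).1, hL]
  rcases key with ⟨-, h, -⟩ | ⟨-, h, -⟩ | ⟨L', h, h'⟩
  · simp [h] at hL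
  · simp [h] at hL
  · obtain rfl : L' = L := by simpa [h] using hL
    exact h'

/-! ### Stability -/

variable (P pr v₀) in
/-- Under the schedule `s` the first `K` steps end with an anchor, and both processes are idle
then. -/
structure Anchored (s : ℕ → Bool) (K a e : ℕ) (L : List V) : Prop where
  anchor : (hist P pr v₀ s).atTop.IsAnchor a e L
  -- The response is the first event of step `K - 1`, the last one before `K`.
  last : e + 2 = 2 * K
  idle : ∀ b, ((conf P pr v₀ s K).loc b).idle = true

/-- The winner from the point of view of process `b`, whose local state is `l` and which has
performed `r` operations when the competition starts: it wins if the next response is a list of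
length `M`. -/
def decision (r : Bool → ℕ) (M : ℕ) (b : Bool) (l : Local P) : Option Bool :=
  l.log[r b]?.map fun L => if L.length = M then b else !b

variable (P pr v₀) in
/-- The decisions that the processes have reached by step `K'` about a competition that starts
at step `K` are wrong. -/
def Wrong (s : ℕ → Bool) (K M K' : ℕ) : Prop :=
  K ≤ K' ∧
    ((∃ w w', decision (fun b => ((conf P pr v₀ s K).loc b).log.length) M false
        ((conf P pr v₀ s K').loc false) = some w ∧
      decision (fun b => ((conf P pr v₀ s K).loc b).log.length) M true
        ((conf P pr v₀ s K').loc true) = some w' ∧ w ≠ w') ∨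
    ∃ b, (∀ i, K ≤ i → i < K' → s i = b) ∧
      decision (fun b => ((conf P pr v₀ s K).loc b).log.length) M b
        ((conf P pr v₀ s K').loc b) = some (!b))

theorem Anchored.congr {K a e : ℕ} {L : List V} (h : Anchored P pr v₀ s K a e L)
    (hs : ∀ i < K, s i = s' i) : Anchored P pr v₀ s' K a e L := by
  refine ⟨h.anchor.congr (N := 2 * K) (by have := h.last; omega) fun i hi => atTop_congr hs hi,
    h.last, fun b => ?_⟩
  rw [← conf_congr hs]
  exact h.idle b

/-- A wrong decision is a property of a finite prefix, so it persists in the limit of the stages. -/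
theorem Wrong.congr {K M K' : ℕ} (h : Wrong P pr v₀ s K M K') (hs : ∀ i < K', s i = s' i) :
    Wrong P pr v₀ s' K M K' := by
  obtain ⟨hK, h⟩ := h
  refine ⟨hK, ?_⟩
  rw [← conf_congr (s := s) (s' := s') hs,
    ← conf_congr (s := s) (s' := s') fun i hi => hs i (by omega)]
  refine h.imp id ?_
  rintro ⟨b, hb, h⟩
  exact ⟨b, fun i hi hi' => by rw [← hs i hi', hb i hi hi'], h⟩

/-- In a history that is `t`-linearizable the decisions are right if the competition starts with
an anchor in the suffix. -/
theorem Anchored.not_wrong (hpr : pr.Injective) {K a e t : ℕ} {L : List V}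
    (h : Anchored P pr v₀ s K a e L) (hL : t ≤ L.length)
    (ht : (hist P pr v₀ s).atTop.TLinearizable t) (K' : ℕ) :
    ¬ Wrong P pr v₀ s K (L.length + 1) K' := by
  rintro ⟨hK, hwrong⟩
  obtain ⟨-, S, hS⟩ := ht
  have hlast := h.last
  have hsuf : (hist P pr v₀ s).atTop.InSuffix t a :=
    History.inSuffix_of_le_card (by rw [← h.anchor.length]; exact hL)
  have hfirst : ∀ b w, decision (fun b => ((conf P pr v₀ s K).loc b).log.length) (L.length + 1) b
      ((conf P pr v₀ s K').loc b) = some w → ∃ k m L', K ≤ k ∧ m < K' ∧ s k = b ∧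
        (hist P pr v₀ s).atTop.IsResponse (2 * k) (2 * m) L' ∧
        (∀ j p x, K ≤ j → j < m → s j = b →
          (hist P pr v₀ s).atTop (2 * j) = some (.inv p x) → j = k) ∧
        w = if L'.length = L.length + 1 then b else !b := by
    intro b w hw
    obtain ⟨L', hL', rfl⟩ := Option.map_eq_some_iff.mp hw
    obtain ⟨k, m, h1, h2, h3, h4, h5⟩ := exists_first_response hpr hK (h.idle b) hL'
    exact ⟨k, m, L', h1, h2, h3, h4, h5, rfl⟩
  -- `IsAnchor.exists_next` in terms of steps: the next operation is invoked at step `j`, before any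
  -- operation started after the anchor responds.
  have hnext : ∀ k m L', K ≤ k → (hist P pr v₀ s).atTop.IsResponse (2 * k) m L' →
      ∃ j, K ≤ j ∧ (∃ p x, (hist P pr v₀ s).atTop (2 * j) = some (.inv p x)) ∧
        ∀ k₁ m₁ L₁, (hist P pr v₀ s).atTop.IsResponse (2 * k₁) (2 * m₁) L₁ → K ≤ k₁ →
          j < m₁ ∧ (L₁.length = L.length + 1 ↔ k₁ = j) := by
    intro k m L' hk hr
    obtain ⟨i, hi, ⟨p, x, hx⟩, hall⟩ := h.anchor.exists_next hS hsuf hr (by omega)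
    obtain ⟨j, rfl, -⟩ := exists_step_of_atTop hx
    refine ⟨j, by omega, ⟨p, x, hx⟩, fun k₁ m₁ L₁ h₁ hk₁ => ?_⟩
    obtain ⟨h2, h3⟩ := hall _ _ _ h₁ (by omega)
    exact ⟨by omega, h3.trans (by omega)⟩
  rcases hwrong with ⟨w, w', hw, hw', hne⟩ | ⟨b, hb, hw⟩
  · obtain ⟨k, m, L₀, hk, hm, hsk, hr, hf, rfl⟩ := hfirst _ _ hw
    obtain ⟨k', m', L₁, hk', hm', hsk', hr', hf', rfl⟩ := hfirst _ _ hw'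
    obtain ⟨j, hj, ⟨p, x, hx⟩, hall⟩ := hnext k _ _ hk hr
    obtain ⟨h1, h2⟩ := hall _ _ _ hr hk
    obtain ⟨h1', h2'⟩ := hall _ _ _ hr' hk'
    -- The next operation is invoked before the first response of its process, so it is the first
    -- operation of that process in the race. That process sees a list of length `L.length + 1`, and
    -- the other one does not.
    cases hsj : s j with
    | false =>
      have e1 := hf j p x hj h1 hsj hx
      have e2 : k' ≠ j := by
        rintro rfl
        simp [hsj] at hsk'
      rw [if_pos (h2.mpr e1.symm), if_neg fun h => e2 (h2'.mp h)] at hne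
      exact hne rfl
    | true =>
      have e1 := hf' j p x hj h1' hsj hx
      have e2 : k ≠ j := by
        rintro rfl
        simp [hsj] at hsk
      rw [if_pos (h2'.mpr e1.symm), if_neg fun h => e2 (h2.mp h)] at hne
      exact hne rfl
  · obtain ⟨k, m, L', hk, hm, hsk, hr, hf, he⟩ := hfirst _ _ hw
    obtain ⟨j, hj, ⟨p, x, hx⟩, hall⟩ := hnext k _ _ hk hr
    obtain ⟨h1, h2⟩ := hall _ _ _ hr hk
    rw [if_pos (h2.mpr (hf j p x hj h1 (hb j hj (by omega)) hx).symm)] at he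
    cases b <;> simp at he

/-- Every finite execution can be extended to one that ends with an anchor. -/
theorem exists_anchored (hP : P.EventuallyImplements) (hpr : pr.Injective) (s : ℕ → Bool)
    (K w : ℕ) :
    ∃ s' K' a e L, K < K' ∧ (∀ i < K, s' i = s i) ∧ w ≤ L.length ∧
      Anchored P pr v₀ s' K' a e L := by
  -- Let `false` run alone until it is idle, and `true` alone forever after. From then on all
  -- operations are sequential.
  obtain ⟨K₁, hK₁, h1⟩ := exists_idle (P := P) (v₀ := v₀) (s := splice s K fun _ => false)
    (b := false) hP.1 hpr (fun N => ⟨N + K, by omega, splice_of_le (by omega)⟩) K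
  let s' := splice (splice s K fun _ => false) K₁ fun _ => true
  have hinf : ∀ N, ∃ k, N ≤ k ∧ s' k = true := fun N => ⟨N + K₁, by omega, splice_of_le (by omega)⟩
  have htrue : ∀ i, K₁ ≤ i → s' i = true := fun i hi => splice_of_le hi
  have hfalse : ∀ k, K₁ ≤ k → ((conf P pr v₀ s' k).loc false).idle = true := by
    intro k hk
    rw [loc_eq_of_ne hk fun i hi _ => by simp [htrue i hi],
      conf_congr (s := s') fun i hi => splice_of_lt hi]
    exact h1
  obtain ⟨K₂, hK₂, h2⟩ := exists_idle (P := P) (v₀ := v₀) hP.1 hpr hinf K₁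
  have hrun := isRun (P := P) (v₀ := v₀) (s := s') hpr
  have hproc : ∀ i p x, (hist P pr v₀ s').atTop i = some (.inv p x) →
      ∃ j, i = 2 * j ∧ p = pr (s' j) := fun i p x hi => exists_step_of_atTop hi
  have hinfInv : ∀ N, ∃ k, N ≤ k ∧ ∃ p x, (hist P pr v₀ s').atTop k = some (.inv p x) := by
    intro N
    obtain ⟨j, hj, hidle⟩ := exists_idle (P := P) (v₀ := v₀) hP.1 hpr hinf (N + K₁)
    have hsj := htrue j (by omega)
    exact ⟨2 * j, by omega, _, _, inv_of_idle (by rw [hsj]; exact hidle)⟩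
  have hcomp : ∀ k p x, (hist P pr v₀ s').atTop k = some (.inv p x) →
      ∃ m L, (hist P pr v₀ s').atTop.IsResponse k m L := by
    intro k p x hk
    obtain ⟨j, rfl, rfl⟩ := hproc k p x hk
    cases hsj : s' j with
    | true =>
      rw [hsj] at hk
      exact exists_response hP.1 hpr hk hinf
    | false =>
      rw [hsj] at hk
      have hj : j < K₁ := by
        by_contra! hle
        simp [htrue j hle] at hsj
      obtain ⟨m, v, -, hr⟩ := hrun.exists_response_of_idle (k := 2 * K₁) (p := pr false) (by
        rw [states_even hpr, Local.state]
        simp [hfalse K₁ le_rfl]) (by omega) hk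
      exact ⟨m, v, hr⟩
  have hseq : ∀ k k' m L p x, 2 * K₁ ≤ k → k < k' →
      (hist P pr v₀ s').atTop.IsResponse k m L →
      (hist P pr v₀ s').atTop k' = some (.inv p x) → m < k' := by
    intro k k' m L p x hk hkk' hr hk'
    obtain ⟨q, y, hy, -⟩ := id hr
    obtain ⟨j, rfl, rfl⟩ := hproc k q y hy
    obtain ⟨j', rfl, rfl⟩ := hproc k' p x hk'
    rw [htrue j (by omega)] at hy
    rw [htrue j' (by omega)] at hk'
    obtain ⟨m', v, hm', hr'⟩ := hrun.wellFormed.2 _ _ _ _ _ hkk' hy hk'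
    rw [(hr.unique hr').1]
    exact hm'
  obtain ⟨-, t, -, S, hS⟩ := hP.2 _ (isExecution (v₀ := v₀) hpr s')
  -- An anchor after `N` has at least `w` operations invoked before it, hence a response of length
  -- at least `w`.
  obtain ⟨N, hN⟩ := History.exists_le_card_invsBefore hinfInv w
  obtain ⟨a, e, L, ha, hA⟩ := hS.exists_isAnchor hcomp hseq hinfInv (N + 2 * K₁)
  have hae := hA.resp.lt
  obtain ⟨p, x, hx, -⟩ := id hA.resp
  obtain ⟨j, rfl, rfl⟩ := hproc a p x hx
  have hsj := htrue j (by omega)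
  rw [hsj] at hx
  obtain ⟨m, rfl, hsm, hidle, -⟩ := step_of_isResponse hpr hA.resp hx
  refine ⟨s', m + 1, 2 * j, 2 * m, L, by omega, fun i hi => ?_, ?_, hA, by omega, fun b => ?_⟩
  · exact (splice_of_lt (by omega)).trans (splice_of_lt hi)
  · rw [hA.length]
    exact hN.trans (Finset.card_le_card (History.invsBefore_mono (by omega)))
  · cases b
    · exact hfalse _ (by omega)
    · exact hidle

/-- After every anchor a wrong decision is possible. -/
theorem Anchored.exists_wrong (hP : P.WaitFree) (hpr : pr.Injective) {K a e : ℕ} {L : List V}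
    (h : Anchored P pr v₀ s K a e L) :
    ∃ s' K', (∀ i < K, s' i = s i) ∧ Wrong P pr v₀ s' K (L.length + 1) K' := by
  by_contra! hno
  let r : Bool → ℕ := fun b => ((conf P pr v₀ s K).loc b).log.length
  have hright : ∀ σ k, ¬ Wrong P pr v₀ (splice s K σ) K (L.length + 1) (K + k) :=
    fun σ k => hno _ _ fun i hi => splice_of_lt hi
  have hconf : ∀ σ, conf P pr v₀ (splice s K σ) K = conf P pr v₀ s K :=
    fun σ => conf_congr fun i hi => splice_of_lt hi
  -- If no continuation led to a wrong decision, the race after the anchor would solve consensus.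
  -- `splice` turns a schedule from step `K` on into one from the beginning.
  refine Config.no_consensus (act := act P pr v₀) (conf P pr v₀ s K)
    (decision r (L.length + 1)) ?_ ?_ ?_ ?_
  · intro C b b' w hw
    obtain ⟨L', hL', rfl⟩ := Option.map_eq_some_iff.mp hw
    obtain ⟨l, hl⟩ := log_step (pr := pr) (v₀ := v₀) C b b'
    refine Option.map_eq_some_iff.mpr ⟨L', ?_, rfl⟩
    rw [← hl, List.getElem?_append_left (List.getElem?_eq_some_iff.mp hL').1, hL']
  · intro σ k w w' hw hw'
    by_contra hne
    refine hright σ k ⟨by omega, .inl ⟨w, w', ?_, ?_, hne⟩⟩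
    · rw [hconf, conf_splice_add]
      exact hw
    · rw [hconf, conf_splice_add]
      exact hw'
  · intro σ b hinf
    have hinf' : ∀ N, ∃ k, N ≤ k ∧ splice s K σ k = b := by
      intro N
      obtain ⟨k, hk, hb⟩ := hinf N
      exact ⟨K + k, by omega, by rw [splice_of_le (by omega)]; simpa using hb⟩
    -- At its first step in the race `b` is still idle, so it invokes an operation; the response
    -- makes its log longer than `r b`, which is a decision.
    obtain ⟨j, ⟨hj, hsj⟩, hmin⟩ : ∃ j, (K ≤ j ∧ splice s K σ j = b) ∧
        ∀ i, K ≤ i → splice s K σ i = b → j ≤ i :=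
      ⟨Nat.find (hinf' K), Nat.find_spec (hinf' K), fun i h1 h2 => Nat.find_min' _ ⟨h1, h2⟩⟩
    have hidle : ((conf P pr v₀ (splice s K σ) j).loc b).idle = true := by
      rw [loc_eq_of_ne hj fun i hi hij hb => by have := hmin i hi hb; omega, hconf]
      exact h.idle b
    have hinv := inv_of_idle (P := P) (pr := pr) (v₀ := v₀) (s := splice s K σ) (k := j)
      (by rw [hsj]; exact hidle)
    rw [hsj] at hinv
    obtain ⟨m, L', hr⟩ := exists_response hP hpr hinv hinf'
    obtain ⟨i, rfl, -, -, hlog⟩ := step_of_isResponse hpr hr hinv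
    have hlt := hr.lt
    have hpre := (log_prefix (P := P) (pr := pr) (v₀ := v₀) (s := splice s K σ) (b := b)
      (show K ≤ i by omega)).length_le
    rw [hconf] at hpre
    obtain ⟨k, hk⟩ : ∃ k, i + 1 = K + k := ⟨i + 1 - K, by omega⟩
    rw [hk, conf_splice_add] at hlog
    have hlen : r b < ((Config.run (act P pr v₀) (conf P pr v₀ s K) σ k).loc b).log.length := by
      rw [hlog, List.length_append, List.length_singleton]
      exact Nat.lt_succ_of_le hpre
    exact ⟨k, _, Option.map_eq_some_iff.mpr ⟨_, List.getElem?_eq_getElem hlen, rfl⟩⟩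
  · intro b k w hw
    by_contra hne
    refine hright (fun _ => b) k ⟨by omega, .inr ⟨b, fun i hi _ => splice_of_le hi, ?_⟩⟩
    rw [hconf, conf_splice_add, ← Bool.eq_not_of_ne hne]
    exact hw

/-- No wait-free program for two or more processes implements an eventually linearizable
fetch-and-cons object from registers and eventually linearizable test-and-set objects. -/
theorem not_eventuallyImplements [Nonempty V] (hpr : pr.Injective) : ¬ P.EventuallyImplements := by
  intro hP
  obtain ⟨v₀⟩ := ‹Nonempty V›
  have hext : ∀ X : (ℕ → Bool) × ℕ, ∃ Y : (ℕ → Bool) × ℕ, X.2 < Y.2 ∧ (∀ i < X.2, Y.1 i = X.1 i) ∧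
      ∃ K a e L, K ≤ Y.2 ∧ X.2 ≤ L.length ∧ Anchored P pr v₀ Y.1 K a e L ∧
        Wrong P pr v₀ Y.1 K (L.length + 1) Y.2 := by
    intro X
    -- The list is required to be at least as long as the number `X.2` of steps so far, so that the
    -- anchors pass every `t`.
    obtain ⟨s', K, a, e, L, hK, hs', hL, hA⟩ := exists_anchored (v₀ := v₀) hP hpr X.1 X.2 X.2
    obtain ⟨s'', K', hs'', hW⟩ := hA.exists_wrong hP.1 hpr
    have hKK' := hW.1
    exact ⟨(s'', K'), by dsimp only; omega, fun i hi => (hs'' i (by omega)).trans (hs' i hi),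
      K, a, e, L, hKK', hL, hA.congr fun i hi => (hs'' i hi).symm, hW⟩
  choose next hnext using hext
  let X : ℕ → (ℕ → Bool) × ℕ := fun i => next^[i] (fun _ => true, 0)
  have hX : ∀ i, X (i + 1) = next (X i) := fun i => Function.iterate_succ_apply' next i _
  have hlt : ∀ i, (X i).2 < (X (i + 1)).2 := fun i => by
    rw [hX]
    exact (hnext (X i)).1
  have hmono : StrictMono fun i => (X i).2 := strictMono_nat_of_lt_succ hlt
  have hagree : ∀ i j, i ≤ j → ∀ k < (X i).2, (X j).1 k = (X i).1 k := by
    intro i j hij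
    induction j, hij using Nat.le_induction with
    | base => exact fun _ _ => rfl
    | succ j hij ih =>
      intro k hk
      rw [hX, (hnext (X j)).2.1 k (lt_of_lt_of_le hk (hmono.monotone hij)), ih k hk]
  -- The limit schedule: stage `k + 1` fixes more than `k` steps, and later stages do not change
  -- them.
  let s : ℕ → Bool := fun k => (X (k + 1)).1 k
  have hs : ∀ i, ∀ k < (X i).2, (X i).1 k = s k := by
    intro i k hk
    have hk' : k < (X (k + 1)).2 := lt_of_lt_of_le (Nat.lt_succ_self k) (hmono.id_le (k + 1))
    rcases le_total i (k + 1) with h | h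
    · exact (hagree i (k + 1) h k hk).symm
    · exact hagree (k + 1) i h k hk'
  obtain ⟨-, t, ht⟩ := hP.2 _ (isExecution (v₀ := v₀) hpr s)
  -- Stage `t` has at least `t` steps, so the anchor added to it lies in the suffix, and the wrong
  -- decision after it is still present in the limit.
  obtain ⟨-, -, K, a, e, L, hK, hL, hA, hW⟩ := hnext (X t)
  rw [← hX] at hK hA hW
  have htL : t ≤ L.length := le_trans (hmono.id_le t) hL
  exact (hA.congr fun i hi => hs (t + 1) i (by omega)).not_wrong hpr htL ht _
    (hW.congr (hs (t + 1)))

end Simulation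

end EventualLin

theorem theorem15 :
    (∀ n : ℕ, ∃ P : EventualLin.Program n (Fin 1) (Fin 0)
        EventualLin.TestAndSet EventualLin.TestAndSet, P.EventuallyImplements) ∧
    (∀ (V : Type) [Primcodable V] [Nonempty V],
      EventualLin.eventualConsensusNumber V EventualLin.TestAndSet = 1) := by
  refine ⟨fun n => ⟨_, EventualLin.registerTestAndSet_eventuallyImplements n⟩, fun V _ _ => ?_⟩
  refine le_antisymm (sSup_le ?_)
    (le_sSup ⟨1, by simp, _, EventualLin.localFetchAndCons_eventuallyImplements V⟩)
  rintro _ ⟨n, rfl, P, hP⟩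
  by_contra! hn
  have hn : 1 < n := by exact_mod_cast hn
  -- Processes `0` and `1` run the race; all others never take a step.
  refine EventualLin.Simulation.not_eventuallyImplements (P := P)
    (pr := fun b => if b then ⟨1, hn⟩ else ⟨0, by omega⟩) ?_ hP
  intro b b' h
  cases b <;> cases b' <;> simp_all
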